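/- Let $R$ be a commutative ring, $H$ a Hopf $R$-algebra which is projective as an $R$-module and has a twisted antipode $\overline S$ (an antipode of $H^{op}$: $\sum\overline S(h_2)h_1=\varepsilon(h)1=\sum h_2\overline S(h_1)$), and $H^*=\mathrm{Hom}_R(H,R)$ with the convolution product $\star$, the right $H$-action $(fh)(k)=f(hk)$, and the notation $f\rightharpoonup k=\sum k_1f(k_2)$, $k\leftharpoonup f=\sum f(k_1)k_2$ for $f\in H^*$, $h,k\in H$. Let $A$ be an $R$-algebra with a weak left $H$-action, i.e. an $R$-linear map $H\otimes_RA\to A$, $h\otimes a\mapsto ha$, with $h(ab)=\sum(h_1a)(h_2b)$, $h1_A=\varepsilon(h)1_A$ and $1_Ha=a$, and let $\sigma:H\otimes_RH\to A$ be $R$-linear and invertible for convolution, such that $A\#_\sigma H:=A\otimes_RH$ with the multiplication $(a\#h)(b\#k)=\sum a(h_1b)\sigma(h_2\otimes k_1)\#h_3k_2$ is associative with unit $1\#1$ (a right $H$-crossed product with invertible cocycle). Let $U\subseteq H^*$ be a (not necessarily unital) subalgebra that is stable under the right $H$-action, and let $(A\#_\sigma H)\#U:=(A\#_\sigma H)\otimes_RU$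 have the multiplication $(x\#f)(y\#g)=\sum xy_{<0>}\#(fy_{<1>})\star g$, where $(a\#h)_{<0>}\otimes(a\#h)_{<1>}=(a\#h_1)\otimes h_2$. Let $V\subseteq H^*$ be a right $H$-submodule such that $(V,U)$ is compatible, i.e.: 1. for all $h\in H$, $a\in A$, the maps $k\mapsto\sum[\overline S(k_2)a]\,\sigma(\overline S(k_1)\otimes h)$ and $k\mapsto\sum\sigma^{-1}(k_3\otimes\overline S(k_2))[k_4a]\,\sigma(k_5\otimes\overline S(k_1)h)$ lie in the image of the canonical map $A\otimes_RV\to\mathrm{Hom}_R(H,A)$; 2. for every $g\in V$ there are finitely many $h_j\in H$, $g_j\in U$ with $k\leftharpoonup g=\sum_jh_j(g_j\rightharpoonup k)$ for all $k\in H$. Let $\alpha:(A\otimes_RH)\otimes_RU\to\mathrm{Hom}_R(H,A\otimes_RH)$ be the map $m\otimes f\mapsto[k\mapsto f(k)m]$. Density refers to the finite topology (pointwise convergence with discrete values), and a submodule $K\subseteq M$ is called $N$-pure if $K\otimes_RN\to M\otimes_RN$ is injective, and pure if it is $N$-pure for every $R$-module $N$. (i) If $U\subseteq H^*$ is dense and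 $\alpha$ is injective, then there are a dense $R$-subalgebra $\mathcal L\subseteq\mathrm{End}_R(H)$ and an isomorphism of $R$-algebras $(A\#_\sigma H)\#U\simeq A\otimes_R\mathcal L$. (If $\varepsilon\in U$, then $\mathrm{id}_H\in\mathcal L$ and the isomorphism is one of unital algebras.) (ii) The map $\alpha$ is injective if $R$ is Noetherian and $U\subseteq R^H$ is $A$-pure. (iii) Suppose that $R$ is a QF ring (Noetherian and self-injective), put $H^\circ=\{f\in H^*\mid HfH\text{ is a finitely generated }R\text{-module}\}$, where $HfH$ is generated by the functionals $x\mapsto f(bxa)$ with $a,b\in H$, and suppose that $H^\circ\subseteq R^H$ is pure ($H$ is a Hopf $\alpha$-algebra), that $H$ is residually finite (the canonical map $H\to(H^\circ)^*$ is injective), and that $U\subseteq H^\circ$ is a dense $R$-subbialgebra: $U$ is pure in $H^\circ$, contains $\varepsilon$, is closed under $\star$, and for every $f\in U$ there is $\sum f_1\otimes f_2\in U\otimes_RU$ with $f(hk)=\sum f_1(h)f_2(k)$ for all $h,k\in H$. Then $U\subseteq H^*$ is dense and $\alpha$ is injective, so that the conclusion of (i) holds. -/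

import Mathlib

open scoped TensorProduct

universe u v w

noncomputable section

namespace HopfDuality

/-! ### Purity, the finite topology, pairings -/

section Modules

variable {R : Type u} [CommRing R]

/-- An embedding `ι : K → M` of `R`-modules is `N`-pure if `K ⊗ N → M ⊗ N` is injective. -/
def IsPureFor {K M : Type*} [AddCommMonoid K] [Module R K] [AddCommMonoid M] [Module R M]
    (ι : K →ₗ[R] M) (N : Type*) [AddCommMonoid N] [Module R N] : Prop :=
  Function.Injective (ι.rTensor N)

/-- Purity in the sense of Cohn: `N`-purity for every `R`-module `N`. (Purity is detected by
finitely presented modules, all of which have a copy in the universe of `R`.) -/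
def IsPure {K M : Type*} [AddCommMonoid K] [Module R K] [AddCommMonoid M] [Module R M]
    (ι : K →ₗ[R] M) : Prop :=
  ∀ (N : Type u) [AddCommGroup N] [Module R N], IsPureFor ι N

/-- The inclusion of a submodule `U ⊆ W^*` into the module `R^W` of all functions. -/
def toFunctions {W : Type*} [AddCommMonoid W] [Module R W] (U : Submodule R (Module.Dual R W)) :
    U →ₗ[R] (W → R) :=
  LinearMap.ltoFun R W R R ∘ₗ U.subtype

/-- The finite topology on `Hom_R(M, N)`: the topology induced by the product topology
on `N^M`, where `N` is discrete. -/
@[reducible] def finiteTopology (M N : Type*) [AddCommMonoid M] [Module R M] [AddCommMonoid N] [Module R N] :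
    TopologicalSpace (M →ₗ[R] N) :=
  TopologicalSpace.induced (fun f => (f : M → N)) (@Pi.topologicalSpace M (fun _ => N) fun _ => ⊥)

/-- `S` is dense in `T` for the finite topology. -/
def IsDenseIn {M N : Type*} [AddCommMonoid M] [Module R M] [AddCommMonoid N] [Module R N]
    (S T : Set (M →ₗ[R] N)) : Prop :=
  S ⊆ T ∧ T ⊆ @closure _ (finiteTopology M N) S

theorem isDenseIn_iff {M N : Type*} [AddCommMonoid M] [Module R M] [AddCommMonoid N] [Module R N]
    {S T : Set (M →ₗ[R] N)} :
    IsDenseIn S T ↔ S ⊆ T ∧ ∀ f ∈ T, ∀ F : Finset M, ∃ g ∈ S, ∀ x ∈ F, g x = f x := by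
  let _ : TopologicalSpace N := ⊥
  have _ : DiscreteTopology N := ⟨rfl⟩
  refine and_congr_right fun _ => forall₂_congr fun f _ => ?_
  rw [finiteTopology, closure_induced, mem_closure_iff]
  constructor
  · intro h F
    obtain ⟨_, ho, g, hg, rfl⟩ := h ((F : Set M).pi fun x => {f x})
      (isOpen_set_pi F.finite_toSet fun _ _ => isOpen_discrete _) (by simp)
    exact ⟨g, hg, fun x hx => ho x hx⟩
  · intro h o ho hf
    obtain ⟨F, u, hu, hF⟩ := isOpen_pi_iff.1 ho _ hf
    obtain ⟨g, hg, hgF⟩ := h F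
    exact ⟨g, hF fun x hx => by simpa only [hgF x hx] using (hu x hx).2, g, hg, rfl⟩

/-- `α_M^P : M ⊗ U → Hom_R(W, M)`, `m ⊗ f ↦ (w ↦ f(w) m)`, for the pairing `P = (W, U)` given by
a submodule `U ⊆ W^*`. -/
def alphaMap {W : Type*} [AddCommMonoid W] [Module R W] (U : Submodule R (Module.Dual R W))
    (M : Type*) [AddCommMonoid M] [Module R M] : M ⊗[R] U →ₗ[R] (W →ₗ[R] M) :=
  TensorProduct.lift ((LinearMap.smulRightₗ (R := R) (M₂ := W) (M := M) ∘ₗ U.subtype).flip)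

/-- Quasi-Frobenius (QF) rings: Noetherian and self-injective. -/
class IsQFRing (R : Type u) [CommRing R] : Prop extends IsNoetherianRing R where
  injective_self : Module.Injective R R

end Modules

/-! ### The dual of a bialgebra -/

section Dual

variable {R : Type u} [CommRing R] {H : Type v} [Ring H]

section Algebra

variable [Algebra R H]

/-- The right regular action of `H` on `H^*`: `(f h)(k) = f(h k)`. -/
def rightAct : Module.Dual R H →ₗ[R] H →ₗ[R] Module.Dual R H :=
  (LinearMap.llcomp R H H R).compl₂ (LinearMap.mul R H)

/-- The left regular action of `H` on `H^*`: `(h f)(k) = f(k h)`. -/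
def leftAct : Module.Dual R H →ₗ[R] H →ₗ[R] Module.Dual R H :=
  (LinearMap.llcomp R H H R).compl₂ (LinearMap.mul R H).flip

/-- The `R`-module `H f H` generated by the functionals `a f b`. -/
def biOrbit (f : Module.Dual R H) : Submodule R (Module.Dual R H) :=
  Submodule.span R (Set.range fun p : H × H => rightAct (leftAct f p.1) p.2)

variable (R H) in
/-- `H° = {f ∈ H^* | H f H is a finitely generated R-module}`, for Noetherian `R`. -/
def finiteDual [IsNoetherianRing R] : Submodule R (Module.Dual R H) where
  carrier := {f | (biOrbit f).FG}
  zero_mem' := by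
    have : biOrbit (0 : Module.Dual R H) = ⊥ := by
      simp [biOrbit]
    simp only [Set.mem_ofPred_eq, this]
    exact Submodule.fg_bot
  add_mem' {f g} hf hg := by
    have hle : biOrbit (f + g) ≤ biOrbit f ⊔ biOrbit g := by
      refine Submodule.span_le.2 ?_
      rintro _ ⟨p, rfl⟩
      simp only [map_add, LinearMap.add_apply]
      exact Submodule.add_mem_sup (Submodule.subset_span ⟨p, rfl⟩)
        (Submodule.subset_span ⟨p, rfl⟩)
    exact Submodule.FG.of_le (Submodule.FG.sup hf hg) hle
  smul_mem' c f hf := by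
    have hle : biOrbit (c • f) ≤ biOrbit f := by
      refine Submodule.span_le.2 ?_
      rintro _ ⟨p, rfl⟩
      simp only [map_smul, LinearMap.smul_apply]
      exact Submodule.smul_mem _ _ (Submodule.subset_span ⟨p, rfl⟩)
    exact Submodule.FG.of_le hf hle

variable (R H) in
/-- `H` is an `α`-algebra: `H° ⊆ R^H` is pure. -/
def IsAlphaAlgebra [IsNoetherianRing R] : Prop :=
  IsPure (toFunctions (finiteDual R H))

variable (R H) in
/-- `H` is residually finite: the canonical map `H → (H°)^*` is injective. -/
def IsResiduallyFinite [IsNoetherianRing R] : Prop :=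
  Function.Injective ((finiteDual R H).subtype.flip : H →ₗ[R] Module.Dual R (finiteDual R H))

/-- `t ∈ W ⊗ W` is the coproduct of `f`: if `t = ∑ f₁ ⊗ f₂`, then `f(h k) = ∑ f₁(h) f₂(k)`.
(When `R` is Noetherian and `W ⊆ R^H` is pure, `t` is determined by `f`.) -/
def IsCoproduct {W : Submodule R (Module.Dual R H)} (f : Module.Dual R H) (t : W ⊗[R] W) : Prop :=
  ∀ h k : H, f (h * k) =
    LinearMap.mul' R R (TensorProduct.map (Module.Dual.eval R H h ∘ₗ W.subtype)
      (Module.Dual.eval R H k ∘ₗ W.subtype) t)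

end Algebra

variable [Bialgebra R H]

/-- The convolution product `(f ⋆ g)(h) = ∑ f(h₁) g(h₂)` on `H^*`. -/
def conv (f g : Module.Dual R H) : Module.Dual R H :=
  (WithConv.toConv f * WithConv.toConv g).ofConv

variable (R H) in
/-- A (not necessarily unital) subalgebra `U` of the convolution algebra `H^*` that is stable under
the right regular action of `H`. -/
structure RightModuleSubalgebra extends Submodule R (Module.Dual R H) where
  conv_mem : ∀ f ∈ toSubmodule, ∀ g ∈ toSubmodule, conv f g ∈ toSubmodule
  act_mem : ∀ f ∈ toSubmodule, ∀ h : H, rightAct f h ∈ toSubmodule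

/-- `U` is an `R`-subbialgebra of `H°`: a unital subalgebra (for convolution, with unit
`ε`) and a subcoalgebra, i.e. a pure submodule of `H°` with `Δ(U) ⊆ U ⊗ U`. -/
structure IsSubbialgebra [IsNoetherianRing R] (U : Submodule R (Module.Dual R H)) : Prop where
  le : U ≤ finiteDual R H
  one_mem : (Coalgebra.counit : Module.Dual R H) ∈ U
  conv_mem : ∀ f ∈ U, ∀ g ∈ U, conv f g ∈ U
  pure : IsPure (Submodule.inclusion le)
  coproduct_mem : ∀ f ∈ U, ∃ t : U ⊗[R] U,
    IsCoproduct f (TensorProduct.map (Submodule.inclusion le) (Submodule.inclusion le) t)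

/-- The left action `f ⇀ k = ∑ k₁ f(k₂)` of `H^*` on `H`. -/
def leftHit (f : Module.Dual R H) : H →ₗ[R] H :=
  TensorProduct.rid R H ∘ₗ f.lTensor H ∘ₗ Coalgebra.comul

/-- The right action `k ↼ f = ∑ f(k₁) k₂` of `H^*` on `H`. -/
def rightHit (f : Module.Dual R H) : H →ₗ[R] H :=
  TensorProduct.lid R H ∘ₗ f.rTensor H ∘ₗ Coalgebra.comul

/-- `(V, U)` satisfies the RL-condition: for every `g ∈ V` there are finitely many
`h_j ∈ H`, `g_j ∈ U` with `k ↼ g = ∑ h_j (g_j ⇀ k)` for all `k ∈ H`. -/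
def RLCondition (V U : Submodule R (Module.Dual R H)) : Prop :=
  ∀ g ∈ V, ∃ (n : ℕ) (x : Fin n → H) (y : Fin n → U),
    ∀ k : H, rightHit g k = ∑ j, x j * leftHit (y j : Module.Dual R H) k

/-- `S'` is a twisted antipode of `H`, i.e. an antipode of `H^op`:
`∑ S'(h₂) h₁ = ε(h) 1 = ∑ h₂ S'(h₁)`. -/
structure IsTwistedAntipode (S' : H →ₗ[R] H) : Prop where
  left : ∀ h : H, LinearMap.mul' R H (TensorProduct.comm R H H
    (S'.lTensor H (Coalgebra.comul h))) = algebraMap R H (Coalgebra.counit h)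
  right : ∀ h : H, LinearMap.mul' R H (TensorProduct.comm R H H
    (S'.rTensor H (Coalgebra.comul h))) = algebraMap R H (Coalgebra.counit h)

end Dual

/-! ### Crossed products -/

section Crossed

variable {R : Type u} [CommRing R] {H : Type v} [Ring H] [Bialgebra R H]
  {A : Type w} [Ring A] [Algebra R A]

/-- A weak left action `h a = act h a` of `H` on `A`: the map `A → Hom_R(H, A)`,
`a ↦ (h ↦ h a)`, is a morphism of algebras for the convolution product, and `1 a = a`. -/
structure IsWeakAction (act : H →ₗ[R] A →ₗ[R] A) : Prop where
  map_one : WithConv.toConv (act.flip 1) = 1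
  map_mul : ∀ a b : A, WithConv.toConv (act.flip (a * b)) =
    WithConv.toConv (act.flip a) * WithConv.toConv (act.flip b)
  one_act : ∀ a : A, act 1 a = a

/-- The multiplication of `A #_σ H = A ⊗ H`:
`(a # h)(b # k) = ∑ a (h₁ b) σ(h₂ ⊗ k₁) # h₃ k₂`, where `b ∈ A`, `k ∈ H`. -/
def crossedMul (act : H →ₗ[R] A →ₗ[R] A) (σ : H ⊗[R] H →ₗ[R] A) :
    A ⊗[R] H →ₗ[R] A ⊗[R] H →ₗ[R] A ⊗[R] H :=
  -- `h ⊗ k ↦ ∑ σ(h₁ ⊗ k₁) ⊗ h₂ k₂`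
  let G : H ⊗[R] H →ₗ[R] A ⊗[R] H :=
    TensorProduct.map σ (LinearMap.mul' R H) ∘ₗ Coalgebra.comul
  -- `(a ⊗ h) ⊗ b ↦ a (h b)`
  let P : (A ⊗[R] H) ⊗[R] A →ₗ[R] A :=
    LinearMap.mul' R A ∘ₗ (TensorProduct.lift act).lTensor A ∘ₗ
      (TensorProduct.assoc R A H A).toLinearMap
  -- `a ⊗ h ↦ ∑ (a ⊗ h₁) ⊗ h₂`
  let D : A ⊗[R] H →ₗ[R] (A ⊗[R] H) ⊗[R] H :=
    (TensorProduct.assoc R A H H).symm.toLinearMap ∘ₗ Coalgebra.comul.lTensor A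
  TensorProduct.curry
    ((LinearMap.mul' R A).rTensor H ∘ₗ (TensorProduct.assoc R A A H).symm.toLinearMap ∘ₗ
      TensorProduct.map P G ∘ₗ
      (TensorProduct.tensorTensorTensorComm R (A ⊗[R] H) H A H).toLinearMap ∘ₗ
      D.rTensor (A ⊗[R] H))

/-- `A #_σ H` is a right `H`-crossed product with invertible cocycle `σ`, and `σ'` is the
convolution inverse of `σ`: `H` acts weakly on `A`, the multiplication of `A #_σ H` is associative
with unit `1 # 1`, and `σ ⋆ σ' = 1 = σ' ⋆ σ` in `Hom_R(H ⊗ H, A)`. -/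
structure IsCrossedProduct (act : H →ₗ[R] A →ₗ[R] A) (σ σ' : H ⊗[R] H →ₗ[R] A) : Prop where
  weak : IsWeakAction act
  assoc : ∀ x y z : A ⊗[R] H,
    crossedMul act σ (crossedMul act σ x y) z = crossedMul act σ x (crossedMul act σ y z)
  one_mul : ∀ x : A ⊗[R] H, crossedMul act σ (1 ⊗ₜ 1) x = x
  mul_one : ∀ x : A ⊗[R] H, crossedMul act σ x (1 ⊗ₜ 1) = x
  mul_inv : WithConv.toConv σ * WithConv.toConv σ' = 1
  inv_mul : WithConv.toConv σ' * WithConv.toConv σ = 1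

/-- The coaction `a # h ↦ ∑ (a # h₁) ⊗ h₂` of `H` on `A #_σ H`. -/
def crossedCoact : A ⊗[R] H →ₗ[R] (A ⊗[R] H) ⊗[R] H :=
  (TensorProduct.assoc R A H H).symm.toLinearMap ∘ₗ Coalgebra.comul.lTensor A

/-- `φ(h ⊗ a)(k) = ∑ [S'(k₂) a] σ(S'(k₁) ⊗ h)`. -/
def phi (S' : H →ₗ[R] H) (act : H →ₗ[R] A →ₗ[R] A) (σ : H ⊗[R] H →ₗ[R] A) (h : H) (a : A) :
    H →ₗ[R] A :=
  LinearMap.mul' R A ∘ₗ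
    TensorProduct.map (act.flip a ∘ₗ S') (σ ∘ₗ (TensorProduct.mk R H H).flip h ∘ₗ S') ∘ₗ
    (TensorProduct.comm R H H).toLinearMap ∘ₗ Coalgebra.comul

/-- `ψ(h ⊗ a)(k) = ∑ σ'(k₃ ⊗ S'(k₂)) [k₄ a] σ(k₅ ⊗ S'(k₁) h)`. -/
def psi (S' : H →ₗ[R] H) (act : H →ₗ[R] A →ₗ[R] A) (σ σ' : H ⊗[R] H →ₗ[R] A) (h : H) (a : A) :
    H →ₗ[R] A :=
  -- `y ↦ ∑ σ'(y₂ ⊗ S'(y₁))`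
  let t : H →ₗ[R] A :=
    σ' ∘ₗ S'.lTensor H ∘ₗ (TensorProduct.comm R H H).toLinearMap ∘ₗ Coalgebra.comul
  -- `y ↦ ∑ σ'(y₂ ⊗ S'(y₁)) [y₃ a]`
  let p : H →ₗ[R] A :=
    LinearMap.mul' R A ∘ₗ TensorProduct.map t (act.flip a) ∘ₗ Coalgebra.comul
  -- `x ⊗ z ↦ σ(z ⊗ S'(x) h)`
  let q : H ⊗[R] H →ₗ[R] A :=
    σ ∘ₗ (LinearMap.mulRight R h ∘ₗ S').lTensor H ∘ₗ (TensorProduct.comm R H H).toLinearMap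
  -- `k ↦ ∑ p(k₂) q(k₁ ⊗ k₃)`
  LinearMap.mul' R A ∘ₗ TensorProduct.map p q ∘ₗ
    (TensorProduct.leftComm R H H H).toLinearMap ∘ₗ
    Coalgebra.comul.lTensor H ∘ₗ Coalgebra.comul

/-- `(V, U)` is compatible: `φ(H ⊗ A)` and `ψ(H ⊗ A)` lie in the image of the canonical map
`J : A ⊗ V → Hom_R(H, A)`, and `(V, U)` satisfies the RL-condition. -/
structure IsCompatible (S' : H →ₗ[R] H) (act : H →ₗ[R] A →ₗ[R] A) (σ σ' : H ⊗[R] H →ₗ[R] A)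
    (V U : Submodule R (Module.Dual R H)) : Prop where
  phi_mem : ∀ (h : H) (a : A), phi S' act σ h a ∈ LinearMap.range (alphaMap V A)
  psi_mem : ∀ (h : H) (a : A), psi S' act σ σ' h a ∈ LinearMap.range (alphaMap V A)
  rl : RLCondition V U

end Crossed

/-! ### Smash products -/

section Smash

variable {R : Type u} [CommRing R] {H : Type v} [Ring H] [Bialgebra R H]

/-- Convolution as a bilinear map on `U`. -/
def RightModuleSubalgebra.mul (U : RightModuleSubalgebra R H) :
    U.toSubmodule →ₗ[R] U.toSubmodule →ₗ[R] U.toSubmodule :=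
  LinearMap.mk₂ R (fun f g => ⟨conv f g, U.conv_mem _ f.2 _ g.2⟩)
    (fun f f' g => Subtype.ext (by simp [conv, add_mul]))
    (fun c f g => Subtype.ext (by simp [conv, smul_mul_assoc]))
    (fun f g g' => Subtype.ext (by simp [conv, mul_add]))
    (fun c f g => Subtype.ext (by simp [conv, mul_smul_comm]))

/-- The right regular action of `H` as a bilinear map on `U`. -/
def RightModuleSubalgebra.act (U : RightModuleSubalgebra R H) :
    U.toSubmodule →ₗ[R] H →ₗ[R] U.toSubmodule :=
  LinearMap.mk₂ R (fun f h => ⟨rightAct f h, U.act_mem _ f.2 h⟩)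
    (fun f f' h => Subtype.ext (by simp))
    (fun c f h => Subtype.ext (by simp))
    (fun f h h' => Subtype.ext (by simp))
    (fun c f h => Subtype.ext (by simp))

/-- The multiplication of the smash product `B # U = B ⊗ U`, where `B` is an `H`-comodule algebra
with multiplication `mulB` and coaction `ρ`:
`(b # f)(b' # f') = ∑ b b'₍₀₎ # (f b'₍₁₎) ⋆ f'`. -/
def smashMul {B : Type*} [AddCommMonoid B] [Module R B] (mulB : B →ₗ[R] B →ₗ[R] B)
    (ρ : B →ₗ[R] B ⊗[R] H) (U : RightModuleSubalgebra R H) :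
    B ⊗[R] U.toSubmodule →ₗ[R] B ⊗[R] U.toSubmodule →ₗ[R] B ⊗[R] U.toSubmodule :=
  -- `(b ⊗ f) ⊗ h ↦ b ⊗ f h`
  let E : (B ⊗[R] U.toSubmodule) ⊗[R] (B ⊗[R] H) →ₗ[R] B ⊗[R] U.toSubmodule :=
    TensorProduct.map (TensorProduct.lift mulB) (TensorProduct.lift U.act) ∘ₗ
      (TensorProduct.tensorTensorTensorComm R B U.toSubmodule B H).toLinearMap
  TensorProduct.curry
    ((TensorProduct.lift U.mul).lTensor B ∘ₗ
      (TensorProduct.assoc R B U.toSubmodule U.toSubmodule).toLinearMap ∘ₗ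
      E.rTensor U.toSubmodule ∘ₗ
      (TensorProduct.assoc R (B ⊗[R] U.toSubmodule) (B ⊗[R] H) U.toSubmodule).symm.toLinearMap ∘ₗ
      (ρ.rTensor U.toSubmodule).lTensor (B ⊗[R] U.toSubmodule))

variable {A : Type w} [Ring A] [Algebra R A]

/-- There are a dense subalgebra `L ⊆ End_R(H)` and an isomorphism of `R`-algebras
`(A #_σ H) # U ≃ A ⊗ L`. As `U` need not contain the unit `ε` of `H^*`, the algebras need not be
unital; if `ε ∈ U`, then `L` contains `id_H` and the isomorphism preserves units. -/
def HasDenseDuality (act : H →ₗ[R] A →ₗ[R] A) (σ : H ⊗[R] H →ₗ[R] A)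
    (U : RightModuleSubalgebra R H) : Prop :=
  ∃ L : NonUnitalSubalgebra R (Module.End R H),
    IsDenseIn (L : Set (Module.End R H)) Set.univ ∧
    ∃ e : (A ⊗[R] H) ⊗[R] U.toSubmodule ≃ₗ[R] A ⊗[R] L,
      (∀ x y, e (smashMul (crossedMul act σ) crossedCoact U x y) = e x * e y) ∧
      ∀ hε : (Coalgebra.counit : Module.Dual R H) ∈ U.toSubmodule,
        ∃ h1 : (1 : Module.End R H) ∈ L,
          e ((1 ⊗ₜ 1) ⊗ₜ ⟨Coalgebra.counit, hε⟩) = 1 ⊗ₜ ⟨1, h1⟩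

end Smash

end HopfDuality

end

open HopfDuality

set_option linter.unusedSectionVars false

noncomputable section

namespace HopfDuality

open TensorProduct Coalgebra

/-! ### Sweedler calculus -/

section Sweedler

variable (R : Type u) [CommRing R] {C : Type v} [AddCommMonoid C] [Module R C]
  {P Q : Type*} [AddCommMonoid P] [Module R P] [AddCommMonoid Q] [Module R Q]

/-! Write B = A #_σ H. The algebra B # U acts on B by (b # f)c = b(f ⇀ c) (`smashRep`). Let L ⊆
End_R(H) be spanned by the operators k ↦ h(f ⇀ k) with h ∈ H, f ∈ U (`hitAlgebra`); then A ⊗ L acts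
on A ⊗ H (`tensorRep`). Both actions commute with right multiplication by A. They are compared
through Θ(a ⊗ k) = γ'(k)a (`theta`), where γ' inverts k ↦ 1 # S'(k) on both sides (`gammaInv_mul`,
`mul_gammaInv`). The map Θ is injective and right A-linear, and the isomorphism sends x to the
unique z with x ∘ Θ = Θ ∘ z. It is multiplicative because Θ intertwines the actions.

Uniqueness: cancelling γ' against S', respectively k₂ against S'(k₁), recovers α from either action
(`alphaMap_eq_smashRep`, `alphaMap_eq_evalHit`), so injectivity of α makes both faithful.

Existence: by right A-linearity only the values at γ'(k) matter. Moving γ' past a # h produces φ in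
one direction (`crossedMul_gammaInv`) and ψ in the other (`gammaInv_crossedMul_tmul`). Compatibility
places these functions in the image of A ⊗ V, and the RL-condition turns operators from V into
operators from H and U (`RLCondition.exists_evalHit`).

Density of L: every T ∈ End_R(H) satisfies T(k) = ∑ G(k₂)k₁ with G(u) = ∑ T(u₂)S'(u₁). A dual basis
of H expands G, and its coordinate functionals are approximated by U.

The sufficient conditions rest on two facts: over a Noetherian ring M ⊗ R^W → M^W is injective, so
purity gives injectivity of α; over a QF ring a submodule of W^* that separates points is dense. -/

/-- `F : C → C → P` is `R`-bilinear. -/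
structure IsBilin (F : C → C → P) : Prop where
  add_left : ∀ x x' y, F (x + x') y = F x y + F x' y
  smul_left : ∀ (r : R) x y, F (r • x) y = r • F x y
  add_right : ∀ x y y', F x (y + y') = F x y + F x y'
  smul_right : ∀ (r : R) x y, F x (r • y) = r • F x y

/-- `F : C → C → C → P` is `R`-trilinear. -/
structure IsTrilin (F : C → C → C → P) : Prop where
  add_left : ∀ x x' y z, F (x + x') y z = F x y z + F x' y z
  smul_left : ∀ (r : R) x y z, F (r • x) y z = r • F x y z
  add_mid : ∀ x y y' z, F x (y + y') z = F x y z + F x y' z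
  smul_mid : ∀ (r : R) x y z, F x (r • y) z = r • F x y z
  add_right : ∀ x y z z', F x y (z + z') = F x y z + F x y z'
  smul_right : ∀ (r : R) x y z, F x y (r • z) = r • F x y z

variable {R}

/-- A bilinear function as a bilinear map. -/
def IsBilin.toLinearMap {F : C → C → P} (hF : IsBilin R F) : C →ₗ[R] C →ₗ[R] P :=
  LinearMap.mk₂ R F hF.add_left hF.smul_left hF.add_right hF.smul_right

/-- A trilinear function as a trilinear map. -/
def IsTrilin.toLinearMap {F : C → C → C → P} (hF : IsTrilin R F) :
    C →ₗ[R] C →ₗ[R] C →ₗ[R] P :=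
  LinearMap.mk₂ R
    (fun x y => { toFun := F x y, map_add' := hF.add_right x y, map_smul' := fun r => hF.smul_right r x y })
    (fun x x' y => LinearMap.ext fun z => hF.add_left x x' y z)
    (fun r x y => LinearMap.ext fun z => hF.smul_left r x y z)
    (fun x y y' => LinearMap.ext fun z => hF.add_mid x y y' z)
    (fun r x y => LinearMap.ext fun z => hF.smul_mid r x y z)

variable (R) [Coalgebra R C]

/-- `sw R k F = ∑ F(k₁, k₂)`. -/
def sw (k : C) (F : C → C → P) : P :=
  ∑ i ∈ (ℛ R k).index, F ((ℛ R k).left i) ((ℛ R k).right i)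

variable {R}

theorem comul_eq_sw (k : C) : (comul k : C ⊗[R] C) = sw R k fun x y => x ⊗ₜ y :=
  (ℛ R k).eq.symm

theorem map_sw {E : Type*} [FunLike E P Q] [AddMonoidHomClass E P Q] (L : E) (k : C) (F : C → C → P) :
    L (sw R k F) = sw R k fun x y => L (F x y) :=
  map_sum L _ _

theorem sw_apply {M : Type*} [AddCommMonoid M] [Module R M] (k : C) (F : C → C → M →ₗ[R] P) (m : M) :
    sw R k F m = sw R k fun x y => F x y m :=
  LinearMap.sum_apply _ _ _

theorem sw_tmul (k : C) (F : C → C → P) (q : Q) :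
    sw R k F ⊗ₜ[R] q = sw R k fun x y => F x y ⊗ₜ[R] q :=
  TensorProduct.sum_tmul _ _ _

theorem tmul_sw (k : C) (F : C → C → P) (q : Q) :
    q ⊗ₜ[R] sw R k F = sw R k fun x y => q ⊗ₜ[R] F x y :=
  TensorProduct.tmul_sum _ _ _

theorem sw_mul_right {A : Type*} [Ring A] [Algebra R A] (k : C) (F : C → C → A) (a : A) :
    sw R k F * a = sw R k fun x y => F x y * a :=
  Finset.sum_mul _ _ _

theorem mul_sw {A : Type*} [Ring A] [Algebra R A] (k : C) (F : C → C → A) (a : A) :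
    a * sw R k F = sw R k fun x y => a * F x y :=
  Finset.mul_sum _ _ _

theorem smul_sw (k : C) (F : C → C → P) (r : R) :
    r • sw R k F = sw R k fun x y => r • F x y :=
  Finset.smul_sum

theorem sw_add_fun (k : C) (F G : C → C → P) :
    (sw R k fun x y => F x y + G x y) = sw R k F + sw R k G :=
  Finset.sum_add_distrib

theorem sw_congr {k : C} {F G : C → C → P} (h : ∀ x y, F x y = G x y) : sw R k F = sw R k G :=
  Finset.sum_congr rfl fun _ _ => h _ _

theorem sw_comm {D : Type*} [AddCommMonoid D] [Module R D] [Coalgebra R D] (h : C) (k : D)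
    (F : C → C → D → D → P) :
    (sw R h fun x y => sw R k fun z t => F x y z t) =
      sw R k fun z t => sw R h fun x y => F x y z t :=
  Finset.sum_comm

/-- For bilinear F the sum no longer depends on the chosen representation of Δ(k). Additivity in k
and the rules for Δ(hk), Δ(1) and Δ(S'(k)) come from here. -/
theorem sw_eq_lift {F : C → C → P} (hF : IsBilin R F) (k : C) :
    sw R k F = TensorProduct.lift hF.toLinearMap (comul k) := by
  rw [comul_eq_sw, map_sw]; rfl

theorem sw_add {F : C → C → P} (hF : IsBilin R F) (k k' : C) :
    sw R (k + k') F = sw R k F + sw R k' F := by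
  simp only [sw_eq_lift hF, map_add]

theorem sw_smul {F : C → C → P} (hF : IsBilin R F) (r : R) (k : C) :
    sw R (r • k) F = r • sw R k F := by
  simp only [sw_eq_lift hF, map_smul]

theorem isBilin_iff {F : C → C → P} : IsBilin R F ↔
    (∀ x x' y, F (x + x') y = F x y + F x' y) ∧ (∀ (r : R) x y, F (r • x) y = r • F x y) ∧
    (∀ x y y', F x (y + y') = F x y + F x y') ∧ ∀ (r : R) x y, F x (r • y) = r • F x y :=
  ⟨fun h => ⟨h.1, h.2, h.3, h.4⟩, fun h => ⟨h.1, h.2.1, h.2.2.1, h.2.2.2⟩⟩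

variable (R)

/-- Coassociativity: `∑ F(k₁₁, k₁₂, k₂) = ∑ F(k₁, k₂₁, k₂₂)`. -/
theorem sw_coassoc (k : C) (F : C → C → C → P)
    (hF : IsTrilin R F := by
      constructor <;> intros <;> (try simp [add_mul, mul_add,
      TensorProduct.add_tmul, TensorProduct.tmul_add, ← TensorProduct.smul_tmul', add_smul, smul_add,
      sw_add_fun, ← smul_sw, mul_smul, sw_add, sw_smul, isBilin_iff])
      <;> simp only [smul_smul, mul_comm, mul_left_comm]) :
    (sw R k fun x z => sw R x fun a b => F a b z) = sw R k fun x y => sw R y fun a b => F x a b := by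
  let τ := hF.toLinearMap
  have h := congrArg (TensorProduct.lift (TensorProduct.uncurry (.id R) C C P ∘ₗ τ))
    (coassoc_apply (R := R) k)
  simpa only [comul_eq_sw, map_sw, LinearMap.rTensor_tmul, LinearMap.lTensor_tmul, sw_tmul, tmul_sw,
    TensorProduct.assoc_tmul, TensorProduct.lift.tmul, LinearMap.comp_apply,
    TensorProduct.uncurry_apply] using! h

theorem sw_counit_left (k : C) (F : C → P)
    (hF : IsLinearMap R F := by
      constructor <;> intros <;> (try simp [add_mul, mul_add,
      TensorProduct.add_tmul, TensorProduct.tmul_add, ← TensorProduct.smul_tmul', add_smul, smul_add,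
      sw_add_fun, ← smul_sw, mul_smul, sw_add, sw_smul, isBilin_iff])
      <;> simp only [smul_smul, mul_comm, mul_left_comm]) :
    (sw R k fun x y => counit (R := R) x • F y) = F k := by
  have h := congrArg hF.mk' (sum_counit_smul (ℛ R k))
  simpa only [map_sum, map_smul] using! h

theorem sw_counit_right (k : C) (F : C → P)
    (hF : IsLinearMap R F := by
      constructor <;> intros <;> (try simp [add_mul, mul_add,
      TensorProduct.add_tmul, TensorProduct.tmul_add, ← TensorProduct.smul_tmul', add_smul, smul_add,
      sw_add_fun, ← smul_sw, mul_smul, sw_add, sw_smul, isBilin_iff])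
      <;> simp only [smul_smul, mul_comm, mul_left_comm]) :
    (sw R k fun x y => counit (R := R) y • F x) = F k := by
  have h := congrArg (TensorProduct.lift ((LinearMap.lsmul R P).flip ∘ₗ hF.mk'))
    (lTensor_counit_comul (R := R) k)
  simpa [comul_eq_sw, map_sw] using h

end Sweedler

/-! ### Sweedler sums over products, and identities for the twisted antipode -/

section Bialgebra

variable {R : Type u} [CommRing R] {H : Type v} [Ring H] [Bialgebra R H]
  {P : Type*} [AddCommMonoid P] [Module R P]

theorem sw_mul {F : H → H → P} (hF : IsBilin R F) (h k : H) :
    sw R (h * k) F = sw R h fun h₁ h₂ => sw R k fun k₁ k₂ => F (h₁ * k₁) (h₂ * k₂) := by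
  rw [sw_eq_lift hF, Bialgebra.comul_mul, comul_eq_sw h, comul_eq_sw k, sw_mul_right, map_sw]
  refine sw_congr fun x y => ?_
  rw [mul_sw, map_sw]
  exact sw_congr fun a b => by
    rw [Algebra.TensorProduct.tmul_mul_tmul]; rfl

theorem sw_one {F : H → H → P} (hF : IsBilin R F) : sw R (1 : H) F = F 1 1 := by
  rw [sw_eq_lift hF, Bialgebra.comul_one]
  rfl

theorem comul_tmul_eq_sw {C D : Type*} [AddCommMonoid C] [Module R C] [Coalgebra R C]
    [AddCommMonoid D] [Module R D] [Coalgebra R D] (h : C) (k : D) :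
    comul (R := R) (h ⊗ₜ[R] k) = sw R h fun h₁ h₂ => sw R k fun k₁ k₂ =>
      (h₁ ⊗ₜ[R] k₁) ⊗ₜ[R] (h₂ ⊗ₜ[R] k₂) := by
  rw [TensorProduct.comul_tmul, comul_eq_sw h, comul_eq_sw k]
  simp only [sw_tmul, tmul_sw, map_sw]
  rw [sw_comm]
  rfl

/-! ### Twisted antipodes -/

variable {S' : H →ₗ[R] H}

theorem IsTwistedAntipode.sw_left (hS' : IsTwistedAntipode S') (k : H) :
    (sw R k fun x y => S' y * x) = counit (R := R) k • (1 : H) := by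
  simpa [comul_eq_sw, map_sw, Algebra.algebraMap_eq_smul_one] using hS'.left k

theorem IsTwistedAntipode.sw_right (hS' : IsTwistedAntipode S') (k : H) :
    (sw R k fun x y => y * S' x) = counit (R := R) k • (1 : H) := by
  simpa [comul_eq_sw, map_sw, Algebra.algebraMap_eq_smul_one] using hS'.right k

/-- Apply ε to ∑ S'(k₂)k₁ = ε(k)1 and absorb ε(k₁) by the counit axiom. -/
theorem IsTwistedAntipode.counit_apply (hS' : IsTwistedAntipode S') (k : H) :
    counit (R := R) (S' k) = counit (R := R) k := by
  have h := congrArg (counit (R := R)) (hS'.sw_left k)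
  simp only [map_sw, Bialgebra.counit_mul, map_smul, Bialgebra.counit_one, smul_eq_mul,
    mul_one] at h
  rw [← h, ← sw_counit_left R k fun z => counit (R := R) (S' z)]
  exact sw_congr fun x y => mul_comm _ _

/-- `∑ S'(h₂ k) h₁ = ε(h) S'(k)`. -/
theorem IsTwistedAntipode.sw_mul_cancel (hS' : IsTwistedAntipode S') (h k : H) :
    (sw R h fun x y => S' (y * k) * x) = counit (R := R) h • S' k := by
  -- Insert ε(k₁) = ∑ k₂S'(k₁) on the right. Summed over h, the remaining front factor is ∑ S'(l₂)l₁
  -- for l = hz, where z is the second leg of k, so it collapses to ε(hz).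
  have e (x y : H) : S' (y * k) * x =
      sw R k fun k₁ z => sw R z fun a b => S' (y * b) * (x * a) * S' k₁ := by
    rw [← sw_coassoc R k (fun k₁ a b => S' (y * b) * (x * a) * S' k₁),
      ← sw_counit_left R k (fun z => S' (y * z) * x)]
    refine sw_congr fun u b => ?_
    simp only [mul_assoc, ← mul_sw, hS'.sw_right]
    simp
  have hb : IsBilin R fun x y : H => S' y * x := by
    constructor <;> intros <;> simp [add_mul, mul_add]
  simp only [e]
  rw [sw_comm, ← sw_counit_right R k (fun z => counit (R := R) h • S' z)
    ⟨by simp, fun c x => by rw [map_smul, smul_comm]⟩]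
  refine sw_congr fun k₁ z => ?_
  simp only [← sw_mul_right]
  rw [← sw_mul hb, hS'.sw_left, Bialgebra.counit_mul, smul_mul_assoc, one_mul, mul_comm, mul_smul]

/-- `Δ(S'(k)) = ∑ S'(k₂) ⊗ S'(k₁)`. -/
theorem IsTwistedAntipode.comul_apply (hS' : IsTwistedAntipode S') (k : H) :
    comul (R := R) (S' k) = sw R k fun x y => S' y ⊗ₜ[R] S' x := by
  -- Uniqueness of inverses for the product ∑ f(u₂)g(u₁): Δ ∘ S' is a left inverse of Δ by `e1`, and
  -- the right-hand side is a right inverse by `e2`.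
  have e1 (u : H) : (sw R u fun x y => comul (R := R) (S' y) * comul x) =
      counit (R := R) u • (1 : H ⊗[R] H) := by
    simp only [← Bialgebra.comul_mul, ← map_sw, hS'.sw_left, map_smul, Bialgebra.comul_one]
  have e2 (u : H) : (sw R u fun z y => comul (R := R) y * sw R z fun a b => S' b ⊗ₜ[R] S' a) =
      counit (R := R) u • (1 : H ⊗[R] H) := by
    calc _ = sw R u fun z y => sw R z fun a b => sw R y fun c d => (c * S' b) ⊗ₜ[R] (d * S' a) := by
          refine sw_congr fun z y => ?_
          simp only [comul_eq_sw y, mul_sw, sw_mul_right, Algebra.TensorProduct.tmul_mul_tmul]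
      _ = sw R u fun a t => sw R t fun b y => sw R y fun c d => (c * S' b) ⊗ₜ[R] (d * S' a) := by
          exact sw_coassoc R u (fun a b y => sw R y fun c d => (c * S' b) ⊗ₜ[R] (d * S' a))
      _ = sw R u fun a t => sw R t fun z d => sw R z fun b c => (c * S' b) ⊗ₜ[R] (d * S' a) := by
          refine sw_congr fun a t => ?_
          rw [← sw_coassoc R t fun b c d => (c * S' b) ⊗ₜ[R] (d * S' a)]
      _ = sw R u fun a t => 1 ⊗ₜ[R] (t * S' a) := by
          refine sw_congr fun a t => ?_
          rw [← sw_counit_left R t fun d => (1 : H) ⊗ₜ[R] (d * S' a)]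
          refine sw_congr fun z d => ?_
          rw [← sw_tmul, hS'.sw_right, TensorProduct.smul_tmul']
      _ = _ := by
          rw [← tmul_sw, hS'.sw_right, TensorProduct.tmul_smul, Algebra.TensorProduct.one_def]
  calc _ = sw R k fun z t => comul (R := R) (S' t) *
        sw R z fun w y => comul (R := R) y * sw R w fun a b => S' b ⊗ₜ[R] S' a := by
        rw [← sw_counit_left R k fun t => comul (R := R) (S' t)]
        refine sw_congr fun z t => ?_
        rw [e2, mul_smul_comm, mul_one]
    _ = sw R k fun w u => (sw R u fun y t => comul (R := R) (S' t) * comul y) *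
          sw R w fun a b => S' b ⊗ₜ[R] S' a := by
        simp only [sw_mul_right]
        rw [← sw_coassoc R k fun w y t => comul (R := R) (S' t) * comul y *
          sw R w fun a b => S' b ⊗ₜ[R] S' a]
        simp only [mul_sw (R := R) (C := H), mul_assoc]
    _ = _ := by
        simp only [e1, smul_mul_assoc, one_mul]
        exact sw_counit_right R k fun w => sw R w fun a b => S' b ⊗ₜ[R] S' a

end Bialgebra

/-! ### The crossed product as a comodule algebra, and the inverse of k ↦ 1 # S'(k) -/

section Crossed

variable {R : Type u} [CommRing R] {H : Type v} [Ring H] [Bialgebra R H]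
  {A : Type w} [Ring A] [Algebra R A]
  {S' : H →ₗ[R] H} {act : H →ₗ[R] A →ₗ[R] A} {σ σ' : H ⊗[R] H →ₗ[R] A}

theorem crossedMul_tmul (a b : A) (h k : H) : crossedMul act σ (a ⊗ₜ h) (b ⊗ₜ k) =
    sw R h fun h₁ t => sw R t fun h₂ h₃ => sw R k fun k₁ k₂ =>
      (a * act h₁ b * σ (h₂ ⊗ₜ k₁)) ⊗ₜ[R] (h₃ * k₂) := by
  simp [crossedMul, comul_eq_sw h, map_sw, sw_tmul, tmul_sw, comul_tmul_eq_sw, mul_assoc,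
    -TensorProduct.comul_tmul]

theorem crossedCoact_tmul (a : A) (h : H) :
    crossedCoact (R := R) (a ⊗ₜ h) = sw R h fun x y => (a ⊗ₜ[R] x) ⊗ₜ[R] y := by
  simp [crossedCoact, comul_eq_sw, map_sw, tmul_sw]

variable (R H A) in
/-- `a ⊗ h ↦ a ε(h)`. -/
def counitCoeff : A ⊗[R] H →ₗ[R] A := TensorProduct.rid R A ∘ₗ (counit (R := R)).lTensor A

@[simp]
theorem counitCoeff_tmul (a : A) (h : H) :
    counitCoeff R H A (a ⊗ₜ h) = counit (R := R) h • a := by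
  simp [counitCoeff]

/-- The counit axiom of the comodule A ⊗ H. It allows a product to be reconstructed from the
A-coefficients of products of coaction components. -/
theorem rTensor_counitCoeff_crossedCoact (x : A ⊗[R] H) :
    (counitCoeff R H A).rTensor H (crossedCoact x) = x := by
  induction x with
  | zero => simp
  | add x y hx hy => simp only [map_add, hx, hy]
  | tmul a h =>
    simp only [crossedCoact_tmul, map_sw, LinearMap.rTensor_tmul, counitCoeff_tmul]
    simp only [TensorProduct.smul_tmul, TensorProduct.tmul_smul]
    exact sw_counit_left R h fun y => a ⊗ₜ[R] y

theorem counitCoeff_crossedMul_tmul (a b : A) (h k : H) :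
    counitCoeff R H A (crossedMul act σ (a ⊗ₜ h) (b ⊗ₜ k)) =
      sw R h fun h₁ h₂ => a * act h₁ b * σ (h₂ ⊗ₜ k) := by
  simp only [crossedMul_tmul, map_sw, counitCoeff_tmul, Bialgebra.counit_mul, mul_smul]
  refine sw_congr fun h₁ t => ?_
  rw [← sw_counit_right R t fun t => a * act h₁ b * σ (t ⊗ₜ k)]
  refine sw_congr fun h₂ h₃ => ?_
  rw [← smul_sw, sw_counit_right R k fun k => a * act h₁ b * σ (h₂ ⊗ₜ k)]

/-- The coaction only sees the last leg h₃k₂ of the product, so this is multiplicativity of Δ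
followed by coassociativity. Associativity of the crossed product plays no role. -/
theorem crossedCoact_crossedMul (x y : A ⊗[R] H) : crossedCoact (crossedMul act σ x y) =
    TensorProduct.map₂ (crossedMul act σ) (LinearMap.mul R H) (crossedCoact x)
      (crossedCoact y) := by
  induction x with
  | zero => simp
  | add x x' hx hx' => simp only [map_add, LinearMap.add_apply, hx, hx']
  | tmul a h =>
  induction y with
  | zero => simp
  | add y y' hy hy' => simp only [map_add, hy, hy']
  | tmul b k =>
    calc _ = sw R h fun h₁ u => sw R u fun h₂ t => sw R k fun k₁ r => sw R (t * r) fun p q =>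
          (a * act h₁ b * σ (h₂ ⊗ₜ k₁)) ⊗ₜ[R] p ⊗ₜ[R] q := by
          simp only [crossedMul_tmul, crossedCoact_tmul, map_sw]
      _ = sw R h fun h₁ u => sw R u fun h₂ t => sw R k fun k₁ r => sw R t fun h₃ h₄ =>
          sw R r fun k₂ k₃ => (a * act h₁ b * σ (h₂ ⊗ₜ k₁)) ⊗ₜ[R] (h₃ * k₂) ⊗ₜ[R] (h₄ * k₃) := by
          refine sw_congr fun h₁ u => sw_congr fun h₂ t => sw_congr fun k₁ r => ?_
          rw [sw_mul]
          constructor <;> intros <;> simp [TensorProduct.add_tmul, TensorProduct.tmul_add,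
            ← TensorProduct.smul_tmul']
      _ = sw R h fun h₁ u => sw R u fun h₂ t => sw R t fun h₃ h₄ => sw R k fun r k₃ =>
          sw R r fun k₁ k₂ => (a * act h₁ b * σ (h₂ ⊗ₜ k₁)) ⊗ₜ[R] (h₃ * k₂) ⊗ₜ[R] (h₄ * k₃) := by
          refine sw_congr fun h₁ u => sw_congr fun h₂ t => ?_
          rw [sw_comm]
          exact sw_congr fun h₃ h₄ => (sw_coassoc R k fun k₁ k₂ k₃ => (a * act h₁ b * σ (h₂ ⊗ₜ k₁)) ⊗ₜ[R] (h₃ * k₂) ⊗ₜ[R] (h₄ * k₃)).symm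
      _ = sw R h fun h₁ u => sw R u fun t h₄ => sw R t fun h₂ h₃ => sw R k fun r k₃ =>
          sw R r fun k₁ k₂ => (a * act h₁ b * σ (h₂ ⊗ₜ k₁)) ⊗ₜ[R] (h₃ * k₂) ⊗ₜ[R] (h₄ * k₃) := by
          refine sw_congr fun h₁ u => ?_
          exact (sw_coassoc R u fun h₂ h₃ h₄ => sw R k fun r k₃ => sw R r fun k₁ k₂ =>
            (a * act h₁ b * σ (h₂ ⊗ₜ k₁)) ⊗ₜ[R] (h₃ * k₂) ⊗ₜ[R] (h₄ * k₃)).symm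
      _ = sw R h fun u h₄ => sw R u fun h₁ t => sw R t fun h₂ h₃ => sw R k fun r k₃ =>
          sw R r fun k₁ k₂ => (a * act h₁ b * σ (h₂ ⊗ₜ k₁)) ⊗ₜ[R] (h₃ * k₂) ⊗ₜ[R] (h₄ * k₃) := by
          exact (sw_coassoc R h fun h₁ t h₄ => sw R t fun h₂ h₃ => sw R k fun r k₃ =>
            sw R r fun k₁ k₂ => (a * act h₁ b * σ (h₂ ⊗ₜ k₁)) ⊗ₜ[R] (h₃ * k₂) ⊗ₜ[R] (h₄ * k₃)).symm
      _ = _ := by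
          simp only [crossedMul_tmul, crossedCoact_tmul, map_sw, sw_apply,
            TensorProduct.map₂_apply_tmul, LinearMap.mul_apply', sw_tmul, TensorProduct.map_tmul]
          rw [sw_comm]
          refine sw_congr fun u h₄ => ?_
          simp only [sw_comm k]

theorem crossedMul_left (a : A) (x y : A ⊗[R] H) :
    crossedMul act σ ((a ⊗ₜ 1) * x) y = (a ⊗ₜ 1) * crossedMul act σ x y := by
  induction x with
  | zero => simp
  | add x x' hx hx' => simp only [mul_add, map_add, LinearMap.add_apply, hx, hx']
  | tmul c h =>
  induction y with
  | zero => simp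
  | add y y' hy hy' => simp only [map_add, hy, hy', mul_add]
  | tmul b k =>
    simp only [Algebra.TensorProduct.tmul_mul_tmul, crossedMul_tmul, mul_sw, one_mul, mul_assoc]

/-- Left A-linearity reduces this to the unit axiom, so σ(1 ⊗ k) need not be computed. -/
theorem crossedMul_tmul_one (hσ : IsCrossedProduct act σ σ') (a : A) (y : A ⊗[R] H) :
    crossedMul act σ (a ⊗ₜ 1) y = (a ⊗ₜ 1) * y := by
  have h := crossedMul_left (act := act) (σ := σ) a (1 ⊗ₜ 1) y
  rwa [Algebra.TensorProduct.tmul_mul_tmul, mul_one, mul_one, hσ.one_mul] at h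

/-- `k ↦ ∑ σ'(k₂ ⊗ S'(k₁))`. -/
def twist (S' : H →ₗ[R] H) (σ' : H ⊗[R] H →ₗ[R] A) : H →ₗ[R] A :=
  σ' ∘ₗ S'.lTensor H ∘ₗ (TensorProduct.comm R H H).toLinearMap ∘ₗ comul

theorem twist_apply (k : H) : twist S' σ' k = sw R k fun x y => σ' (y ⊗ₜ S' x) := by
  simp [twist, comul_eq_sw, map_sw]

/-- `γ'(k) = ∑ σ'(k₂ ⊗ S'(k₁)) # k₃`, the inverse of `k ↦ 1 # S'(k)`. -/
def gammaInv (S' : H →ₗ[R] H) (σ' : H ⊗[R] H →ₗ[R] A) : H →ₗ[R] A ⊗[R] H :=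
  (twist S' σ').rTensor H ∘ₗ comul

theorem gammaInv_apply (k : H) :
    gammaInv S' σ' k = sw R k fun x y => twist S' σ' x ⊗ₜ[R] y := by
  simp [gammaInv, comul_eq_sw, map_sw]

theorem crossedCoact_gammaInv (k : H) : crossedCoact (gammaInv S' σ' k) =
    sw R k fun x y => gammaInv S' σ' x ⊗ₜ[R] y := by
  simp only [gammaInv_apply, map_sw, crossedCoact_tmul, sw_tmul]
  exact (sw_coassoc R k fun a b c => (twist S' σ' a ⊗ₜ[R] b) ⊗ₜ[R] c).symm

theorem IsTwistedAntipode.sw_apply (hS' : IsTwistedAntipode S') {P : Type*} [AddCommMonoid P]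
    [Module R P] (k : H) {F : H → H → P} (hF : IsBilin R F) :
    sw R (S' k) F = sw R k fun x y => F (S' y) (S' x) := by
  rw [sw_eq_lift hF, hS'.comul_apply, map_sw]
  rfl

theorem crossedCoact_antipode (hS' : IsTwistedAntipode S') (k : H) :
    crossedCoact ((1 : A) ⊗ₜ[R] S' k) =
      sw R k fun x y => ((1 : A) ⊗ₜ[R] S' y) ⊗ₜ[R] S' x := by
  rw [crossedCoact_tmul, hS'.sw_apply]
  constructor <;> intros <;> simp [TensorProduct.add_tmul, TensorProduct.tmul_add,
    ← TensorProduct.smul_tmul']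

theorem IsCrossedProduct.sw_inv_mul (hσ : IsCrossedProduct act σ σ') (h k : H) :
    (sw R h fun h₁ h₂ => sw R k fun k₁ k₂ => σ' (h₁ ⊗ₜ k₁) * σ (h₂ ⊗ₜ k₂)) =
      (counit (R := R) h * counit (R := R) k) • (1 : A) := by
  have := congrArg (fun f => f.ofConv (h ⊗ₜ k)) hσ.inv_mul
  simpa [comul_tmul_eq_sw, map_sw, Algebra.algebraMap_eq_smul_one, LinearMap.convMul_def,
    mul_comm, -TensorProduct.comul_tmul] using this

theorem IsWeakAction.act_one (h : IsWeakAction act) (x : H) :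
    act x 1 = counit (R := R) x • (1 : A) := by
  have := congrArg (fun f => f.ofConv x) h.map_one
  simpa [Algebra.algebraMap_eq_smul_one, LinearMap.convOne_def] using this

theorem crossedMul_tmul_one_tmul (hσ : IsCrossedProduct act σ σ') (a : A) (h k : H) :
    crossedMul act σ (a ⊗ₜ h) ((1 : A) ⊗ₜ k) = sw R h fun h₁ h₂ => sw R k fun k₁ k₂ =>
      (a * σ (h₁ ⊗ₜ k₁)) ⊗ₜ[R] (h₂ * k₂) := by
  rw [crossedMul_tmul, ← sw_counit_left R h fun h => sw R h fun h₁ h₂ => sw R k fun k₁ k₂ =>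
      (a * σ (h₁ ⊗ₜ k₁)) ⊗ₜ[R] (h₂ * k₂)]
  simp only [hσ.weak.act_one, mul_smul_comm, mul_one, smul_mul_assoc, ← TensorProduct.smul_tmul',
    smul_sw]

/-- The product expands to ∑ σ'(k₄ ⊗ S'(k₃)) σ(k₅ ⊗ S'(k₂)) # k₆S'(k₁). Since S' reverses Δ, the
coefficient is σ' ⋆ σ evaluated at a tensor with second entry of the form S'(u), hence a product of
counits; then k₂S'(k₁) cancels. -/
theorem gammaInv_mul (hS' : IsTwistedAntipode S') (hσ : IsCrossedProduct act σ σ') (k : H) :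
    (sw R k fun x y => crossedMul act σ (gammaInv S' σ' y) ((1 : A) ⊗ₜ[R] S' x)) =
      counit (R := R) k • ((1 : A) ⊗ₜ[R] (1 : H)) := by
  calc _ = sw R k fun x y => sw R x fun x₁ x₂ => sw R y fun p q => sw R p fun p₁ p₂ =>
        sw R q fun q₁ q₂ => (σ' (p₂ ⊗ₜ S' p₁) * σ (q₁ ⊗ₜ S' x₂)) ⊗ₜ[R] (q₂ * S' x₁) := by
        refine sw_congr fun x y => ?_
        simp only [gammaInv_apply, map_sw, sw_apply, crossedMul_tmul_one_tmul hσ]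
        rw [sw_comm]
        refine sw_congr fun p q => ?_
        simp only [twist_apply, sw_mul_right (R := R) (C := H), sw_tmul]
        have hb (h₁ h₂ : H) : IsBilin R fun k₁ k₂ : H => sw R p fun p₁ p₂ =>
            (σ' (p₂ ⊗ₜ S' p₁) * σ (h₁ ⊗ₜ k₁)) ⊗ₜ[R] (h₂ * k₂) := by
          constructor <;> intros <;> simp [TensorProduct.add_tmul, TensorProduct.tmul_add,
            ← TensorProduct.smul_tmul', sw_add_fun, ← smul_sw, mul_add]
        simp only [hS'.sw_apply x (hb _ _)]
        rw [sw_comm]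
        exact sw_congr fun _ _ => sw_comm _ _ _
    _ = sw R k fun x₁ z => sw R z fun x₂ y => sw R y fun p q => sw R p fun p₁ p₂ =>
        sw R q fun q₁ q₂ => (σ' (p₂ ⊗ₜ S' p₁) * σ (q₁ ⊗ₜ S' x₂)) ⊗ₜ[R] (q₂ * S' x₁) := by
        exact sw_coassoc R k fun x₁ x₂ y => sw R y fun p q => sw R p fun p₁ p₂ =>
          sw R q fun q₁ q₂ => (σ' (p₂ ⊗ₜ S' p₁) * σ (q₁ ⊗ₜ S' x₂)) ⊗ₜ[R] (q₂ * S' x₁)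
    _ = sw R k fun x₁ z => sw R z fun x₂ y => sw R y fun p₁ r => sw R r fun p₂ q =>
        sw R q fun q₁ q₂ => (σ' (p₂ ⊗ₜ S' p₁) * σ (q₁ ⊗ₜ S' x₂)) ⊗ₜ[R] (q₂ * S' x₁) := by
        refine sw_congr fun x₁ z => sw_congr fun x₂ y => ?_
        exact sw_coassoc R y fun p₁ p₂ q =>
          sw R q fun q₁ q₂ => (σ' (p₂ ⊗ₜ S' p₁) * σ (q₁ ⊗ₜ S' x₂)) ⊗ₜ[R] (q₂ * S' x₁)
    _ = sw R k fun x₁ z => sw R z fun x₂ y => sw R y fun p₁ r => sw R r fun t q₂ =>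
        sw R t fun p₂ q₁ => (σ' (p₂ ⊗ₜ S' p₁) * σ (q₁ ⊗ₜ S' x₂)) ⊗ₜ[R] (q₂ * S' x₁) := by
        refine sw_congr fun x₁ z => sw_congr fun x₂ y => sw_congr fun p₁ r => ?_
        exact (sw_coassoc R r fun p₂ q₁ q₂ =>
          (σ' (p₂ ⊗ₜ S' p₁) * σ (q₁ ⊗ₜ S' x₂)) ⊗ₜ[R] (q₂ * S' x₁)).symm
    _ = sw R k fun x₁ z => sw R z fun u r => sw R u fun x₂ p₁ => sw R r fun t q₂ =>
        sw R t fun p₂ q₁ => (σ' (p₂ ⊗ₜ S' p₁) * σ (q₁ ⊗ₜ S' x₂)) ⊗ₜ[R] (q₂ * S' x₁) := by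
        refine sw_congr fun x₁ z => ?_
        exact (sw_coassoc R z fun x₂ p₁ r => sw R r fun t q₂ => sw R t fun p₂ q₁ =>
          (σ' (p₂ ⊗ₜ S' p₁) * σ (q₁ ⊗ₜ S' x₂)) ⊗ₜ[R] (q₂ * S' x₁)).symm
    _ = sw R k fun x₁ z => sw R z fun u r => sw R r fun t q₂ =>
          (counit (R := R) t * counit (R := R) u) • ((1 : A) ⊗ₜ[R] (q₂ * S' x₁)) := by
        refine sw_congr fun x₁ z => sw_congr fun u r => ?_
        rw [sw_comm]
        refine sw_congr fun t q₂ => ?_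
        have h := hσ.sw_inv_mul t (S' u)
        have hb (h₁ h₂ : H) : IsBilin R fun k₁ k₂ : H => σ' (h₁ ⊗ₜ k₁) * σ (h₂ ⊗ₜ k₂) := by
          constructor <;> intros <;> simp [mul_add, add_mul, TensorProduct.tmul_add]
        simp only [hS'.sw_apply _ (hb _ _), hS'.counit_apply] at h
        rw [sw_comm]
        simp only [← sw_tmul]
        rw [h, TensorProduct.smul_tmul']
    _ = sw R k fun x₁ z => (1 : A) ⊗ₜ[R] (z * S' x₁) := by
        refine sw_congr fun x₁ z => ?_
        rw [← sw_counit_left R z fun z => (1 : A) ⊗ₜ[R] (z * S' x₁)]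
        refine sw_congr fun u r => ?_
        rw [← sw_counit_left R r fun z => (1 : A) ⊗ₜ[R] (z * S' x₁)]
        rw [smul_sw]
        refine sw_congr fun t q => ?_
        rw [mul_comm, mul_smul]
    _ = _ := by
        rw [← tmul_sw, hS'.sw_right, TensorProduct.tmul_smul]

/-- `y = ∑ (x₀ y₀)_A ⊗ x₁ y₁`. -/
theorem crossedMul_eq_map₂ (x y : A ⊗[R] H) : crossedMul act σ x y =
    TensorProduct.map₂ ((crossedMul act σ).compr₂ (counitCoeff R H A)) (LinearMap.mul R H)
      (crossedCoact x) (crossedCoact y) := by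
  rw [← rTensor_counitCoeff_crossedCoact (crossedMul act σ x y), crossedCoact_crossedMul]
  generalize crossedCoact (R := R) x = X
  generalize crossedCoact (R := R) y = Y
  induction X with
  | zero => simp
  | add x x' hx hx' => simp only [map_add, LinearMap.add_apply, hx, hx']
  | tmul a h =>
  induction Y with
  | zero => simp
  | add y y' hy hy' => simp only [map_add, hy, hy']
  | tmul b k => simp

theorem crossedMul_assoc (hσ : IsCrossedProduct act σ σ') (x y z : A ⊗[R] H) :
    crossedMul act σ (crossedMul act σ x y) z = crossedMul act σ x (crossedMul act σ y z) :=
  hσ.assoc x y z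

/-- `∑ (1 # S'(k₂)) γ'(k₁) = ε(k)`. -/
theorem mul_gammaInv (hS' : IsTwistedAntipode S') (hσ : IsCrossedProduct act σ σ') (k : H) :
    (sw R k fun x y => crossedMul act σ ((1 : A) ⊗ₜ[R] S' y) (gammaInv S' σ' x)) =
      counit (R := R) k • ((1 : A) ⊗ₜ[R] (1 : H)) := by
  let w (k : H) : A := sw R k fun x y => counitCoeff R H A
    (crossedMul act σ ((1 : A) ⊗ₜ[R] S' y) (gammaInv S' σ' x))
  -- The product is coinvariant, because the coactions contribute S'(k₃)k₂ to the H-factor; hence it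
  -- lies in A ⊗ 1.
  have h1 (k : H) : (sw R k fun x y =>
      crossedMul act σ ((1 : A) ⊗ₜ[R] S' y) (gammaInv S' σ' x)) = w k ⊗ₜ[R] (1 : H) := by
    calc _ = sw R k fun x y => sw R x fun x₁ x₂ => sw R y fun y₁ y₂ => counitCoeff R H A
          (crossedMul act σ ((1 : A) ⊗ₜ[R] S' y₂) (gammaInv S' σ' x₁)) ⊗ₜ[R] (S' y₁ * x₂) := by
          refine sw_congr fun x y => ?_
          rw [crossedMul_eq_map₂, crossedCoact_antipode hS', crossedCoact_gammaInv]
          simp only [map_sw, sw_apply, TensorProduct.map₂_apply_tmul, LinearMap.compr₂_apply,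
            LinearMap.mul_apply', TensorProduct.map_tmul]
      _ = sw R k fun x₁ z => sw R z fun x₂ y => sw R y fun y₁ y₂ => counitCoeff R H A
          (crossedMul act σ ((1 : A) ⊗ₜ[R] S' y₂) (gammaInv S' σ' x₁)) ⊗ₜ[R] (S' y₁ * x₂) := by
          exact sw_coassoc R k fun x₁ x₂ y => sw R y fun y₁ y₂ => counitCoeff R H A
            (crossedMul act σ ((1 : A) ⊗ₜ[R] S' y₂) (gammaInv S' σ' x₁)) ⊗ₜ[R] (S' y₁ * x₂)
      _ = sw R k fun x₁ z => sw R z fun u y₂ => sw R u fun x₂ y₁ => counitCoeff R H A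
          (crossedMul act σ ((1 : A) ⊗ₜ[R] S' y₂) (gammaInv S' σ' x₁)) ⊗ₜ[R] (S' y₁ * x₂) := by
          refine sw_congr fun x₁ z => ?_
          exact (sw_coassoc R z fun x₂ y₁ y₂ => counitCoeff R H A
            (crossedMul act σ ((1 : A) ⊗ₜ[R] S' y₂) (gammaInv S' σ' x₁)) ⊗ₜ[R] (S' y₁ * x₂)).symm
      _ = _ := by
          simp only [← tmul_sw, hS'.sw_left, w, sw_tmul, TensorProduct.tmul_smul]
          refine sw_congr fun x₁ z => ?_
          exact sw_counit_left R z fun y₂ => counitCoeff R H A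
            (crossedMul act σ ((1 : A) ⊗ₜ[R] S' y₂) (gammaInv S' σ' x₁)) ⊗ₜ[R] (1 : H)
  -- Multiply by 1 # S'(k₁) on the right and cancel with `gammaInv_mul`. Applying ε to the H-factor
  -- then forces w = ε(·)1.
  have h2 (k : H) : (sw R k fun x y => w y ⊗ₜ[R] S' x) = (1 : A) ⊗ₜ[R] S' k := by
    calc _ = sw R k fun x y => sw R y fun y₁ y₂ => crossedMul act σ
          (crossedMul act σ ((1 : A) ⊗ₜ[R] S' y₂) (gammaInv S' σ' y₁)) ((1 : A) ⊗ₜ[R] S' x) := by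
          refine sw_congr fun x y => ?_
          rw [← sw_apply, ← map_sw, h1, crossedMul_tmul_one hσ,
            Algebra.TensorProduct.tmul_mul_tmul, mul_one, one_mul]
      _ = sw R k fun z y₂ => sw R z fun x y₁ => crossedMul act σ
          (crossedMul act σ ((1 : A) ⊗ₜ[R] S' y₂) (gammaInv S' σ' y₁)) ((1 : A) ⊗ₜ[R] S' x) := by
          exact (sw_coassoc R k fun x y₁ y₂ => crossedMul act σ
            (crossedMul act σ ((1 : A) ⊗ₜ[R] S' y₂) (gammaInv S' σ' y₁)) ((1 : A) ⊗ₜ[R] S' x)).symm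
      _ = _ := by
          simp only [crossedMul_assoc hσ, ← map_sw, gammaInv_mul hS' hσ, map_smul, hσ.mul_one]
          exact sw_counit_left R k fun y => (1 : A) ⊗ₜ[R] S' y
  have h3 := congrArg (counitCoeff R H A) (h2 k)
  simp only [map_sw, counitCoeff_tmul, hS'.counit_apply] at h3
  have hw : IsLinearMap R w := by
    constructor <;> intros <;> simp [w, sw_add, sw_smul, isBilin_iff, TensorProduct.tmul_add]
  rw [h1, TensorProduct.smul_tmul', ← h3, sw_counit_left R k w hw]

end Crossed

/-! ### The action of H^* on the crossed product -/

section Hit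

variable {R : Type u} [CommRing R] {H : Type v} [Ring H] [Bialgebra R H]
  {A : Type w} [Ring A] [Algebra R A] {act : H →ₗ[R] A →ₗ[R] A} {σ : H ⊗[R] H →ₗ[R] A}

theorem leftHit_apply (f : Module.Dual R H) (k : H) :
    leftHit f k = sw R k fun x y => f y • x := by
  simp [leftHit, comul_eq_sw, map_sw]

theorem rightHit_apply (f : Module.Dual R H) (k : H) :
    rightHit f k = sw R k fun x y => f x • y := by
  simp [rightHit, comul_eq_sw, map_sw]

theorem rightAct_apply (f : Module.Dual R H) (h k : H) : rightAct f h k = f (h * k) := rfl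

theorem conv_apply (f g : Module.Dual R H) (k : H) :
    conv f g k = sw R k fun x y => f x * g y := by
  change LinearMap.mul' R R (TensorProduct.map f g (comul k)) = _
  simp [comul_eq_sw, map_sw]

/-- Multiplicativity of Δ. As operators on H this is the commutation rule f · h = ∑ h₁ · (f h₂),
which keeps the span of the products hf closed under composition. -/
theorem leftHit_mul (f : Module.Dual R H) (h k : H) :
    leftHit f (h * k) = sw R h fun x y => x * leftHit (rightAct f y) k := by
  rw [leftHit_apply, sw_mul]
  · simp only [leftHit_apply, mul_sw, rightAct_apply, mul_smul_comm]
  · constructor <;> intros <;> (try simp [smul_add, add_smul, mul_smul]) <;>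
      simp only [smul_smul, mul_comm]

theorem leftHit_conv (f g : Module.Dual R H) (k : H) :
    leftHit (conv f g) k = leftHit f (leftHit g k) := by
  have h : leftHit (conv f g) k = sw R k fun x t => sw R t fun y z => g z • f y • x := by
    simp only [leftHit_apply, conv_apply]
    refine sw_congr fun x t => ?_
    rw [sw, Finset.sum_smul]
    exact Finset.sum_congr rfl fun i _ => by rw [mul_comm, mul_smul]
  rw [h, leftHit_apply g, map_sw, ← sw_coassoc R k fun x y z => g z • f y • x]
  simp only [map_smul, leftHit_apply, smul_sw]

/-- The action `f ⇀ (a # h) = a # (f ⇀ h)`. -/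
def hit (A : Type w) [Ring A] [Algebra R A] (f : Module.Dual R H) : A ⊗[R] H →ₗ[R] A ⊗[R] H :=
  (leftHit f).lTensor A

theorem hit_conv (f g : Module.Dual R H) (x : A ⊗[R] H) :
    hit A (conv f g) x = hit A f (hit A g x) := by
  have : leftHit (conv f g) = leftHit f ∘ₗ leftHit g := LinearMap.ext (leftHit_conv f g)
  rw [hit, this, LinearMap.lTensor_comp]
  rfl

/-- The action is read off from the coaction, so its rules on products follow from
`crossedCoact_crossedMul`. -/
theorem hit_eq (f : Module.Dual R H) (x : A ⊗[R] H) :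
    hit A f x = TensorProduct.rid R _ (f.lTensor _ (crossedCoact x)) := by
  induction x with
  | zero => simp
  | add x y hx hy => simp only [map_add, hx, hy]
  | tmul a h => simp [hit, crossedCoact_tmul, map_sw, leftHit_apply, tmul_sw]

theorem hit_crossedMul_tmul (f : Module.Dual R H) (a : A) (h : H) (y : A ⊗[R] H) :
    hit A f (crossedMul act σ (a ⊗ₜ h) y) =
      sw R h fun h₁ h₂ => crossedMul act σ (a ⊗ₜ h₁) (hit A (rightAct f h₂) y) := by
  rw [hit_eq, crossedCoact_crossedMul, crossedCoact_tmul]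
  simp only [hit_eq, map_sw, sw_apply, TensorProduct.map₂_apply_tmul]
  refine sw_congr fun h₁ h₂ => ?_
  generalize crossedCoact (R := R) y = Y
  induction Y with
  | zero => simp
  | add y y' hy hy' => simp only [map_add, hy, hy']
  | tmul b k => simp [rightAct_apply]

theorem crossedCoact_tmul_one (a : A) :
    crossedCoact (R := R) (a ⊗ₜ (1 : H)) = (a ⊗ₜ[R] 1) ⊗ₜ[R] 1 := by
  rw [crossedCoact_tmul, sw_one]
  constructor <;> intros <;> simp [TensorProduct.add_tmul, TensorProduct.tmul_add,
    ← TensorProduct.smul_tmul']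

/-- Elements a # 1 are coinvariant. -/
theorem hit_crossedMul_tmul_one (f : Module.Dual R H) (a : A) (x : A ⊗[R] H) :
    hit A f (crossedMul act σ x (a ⊗ₜ 1)) = crossedMul act σ (hit A f x) (a ⊗ₜ 1) := by
  rw [hit_eq, crossedCoact_crossedMul, crossedCoact_tmul_one, hit_eq]
  generalize crossedCoact (R := R) x = X
  induction X with
  | zero => simp
  | add y y' hy hy' => simp only [map_add, LinearMap.add_apply, hy, hy']
  | tmul b k => simp

end Hit

/-! ### The two representations and the comparison map Θ -/

section Operators

variable {R : Type u} [CommRing R] {H : Type v} [Ring H] [Bialgebra R H]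
  {A : Type w} [Ring A] [Algebra R A]
  (act : H →ₗ[R] A →ₗ[R] A) (σ σ' : H ⊗[R] H →ₗ[R] A) (S' : H →ₗ[R] H)
  (U : RightModuleSubalgebra R H)

/-- The action of `(A #_σ H) # U` on `A #_σ H`: `(b # f) c = b (f ⇀ c)`. -/
def smashRep : (A ⊗[R] H) ⊗[R] U.toSubmodule →ₗ[R] Module.End R (A ⊗[R] H) :=
  TensorProduct.lift <| LinearMap.mk₂ R (fun b f => crossedMul act σ b ∘ₗ hit A (f : Module.Dual R H))
    (fun b b' f => by simp [LinearMap.add_comp])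
    (fun c b f => by simp [LinearMap.smul_comp])
    (fun b f f' => by
      ext a h
      simp [hit, leftHit_apply, add_smul, sw_add_fun, TensorProduct.tmul_add])
    (fun c b f => by
      ext a h
      simp [hit, leftHit_apply, mul_smul, ← smul_sw])

variable {act σ σ' S' U}

@[simp]
theorem smashRep_tmul (b : A ⊗[R] H) (f : U.toSubmodule) (c : A ⊗[R] H) :
    smashRep act σ U (b ⊗ₜ f) c = crossedMul act σ b (hit A (f : Module.Dual R H) c) := rfl

theorem smashMul_tmul (b : A ⊗[R] H) (f g : U.toSubmodule) (a : A) (h : H) :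
    smashMul (crossedMul act σ) crossedCoact U (b ⊗ₜ f) ((a ⊗ₜ h) ⊗ₜ g) =
      sw R h fun h₁ h₂ => crossedMul act σ b (a ⊗ₜ h₁) ⊗ₜ U.mul (U.act f h₂) g := by
  simp only [smashMul, crossedCoact_tmul, map_sw, sw_tmul, tmul_sw, TensorProduct.curry_apply,
    LinearMap.comp_apply, LinearMap.lTensor_tmul, LinearMap.rTensor_tmul, LinearEquiv.coe_coe]
  rfl

/-- Three facts match the definition of the smash product: associativity of A #_σ H, the rule for f
⇀ (cz), and that f ⋆ g acts as a composite. -/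
theorem smashRep_smashMul (hσ : IsCrossedProduct act σ σ') (x y : (A ⊗[R] H) ⊗[R] U.toSubmodule) :
    smashRep act σ U (smashMul (crossedMul act σ) crossedCoact U x y) =
      smashRep act σ U x * smashRep act σ U y := by
  induction x with
  | zero => simp
  | add x x' hx hx' => simp only [map_add, LinearMap.add_apply, hx, hx', add_mul]
  | tmul b f =>
  induction y with
  | zero => simp
  | add y y' hy hy' => simp only [map_add, hy, hy', mul_add]
  | tmul c g =>
  induction c with
  | zero => simp
  | add y y' hy hy' => simp only [map_add, hy, hy', TensorProduct.add_tmul, mul_add]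
  | tmul a h =>
    refine LinearMap.ext fun z => ?_
    rw [smashMul_tmul, map_sw, sw_apply, Module.End.mul_apply, smashRep_tmul, smashRep_tmul,
      hit_crossedMul_tmul, map_sw]
    refine sw_congr fun h₁ h₂ => ?_
    rw [smashRep_tmul, crossedMul_assoc hσ]
    congr 2
    exact hit_conv _ _ _

theorem smashRep_crossedMul_tmul_one (hσ : IsCrossedProduct act σ σ')
    (x : (A ⊗[R] H) ⊗[R] U.toSubmodule) (c : A ⊗[R] H) (a : A) :
    smashRep act σ U x (crossedMul act σ c (a ⊗ₜ 1)) =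
      crossedMul act σ (smashRep act σ U x c) (a ⊗ₜ 1) := by
  induction x with
  | zero => simp
  | add x x' hx hx' => simp only [map_add, LinearMap.add_apply, hx, hx']
  | tmul b f => rw [smashRep_tmul, smashRep_tmul, hit_crossedMul_tmul_one, crossedMul_assoc hσ]

theorem hit_gammaInv (f : Module.Dual R H) (k : H) :
    hit A f (gammaInv S' σ' k) = sw R k fun x y => f y • gammaInv S' σ' x := by
  rw [hit_eq, crossedCoact_gammaInv]
  simp [map_sw]

/-- Since γ' is a comodule map, f ⇀ γ'(k) = ∑ f(k₂)γ'(k₁): on γ' an element acts through its image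
under α. -/
theorem smashRep_gammaInv (x : (A ⊗[R] H) ⊗[R] U.toSubmodule) (k : H) :
    smashRep act σ U x (gammaInv S' σ' k) = sw R k fun k₁ k₂ =>
      crossedMul act σ (alphaMap U.toSubmodule (A ⊗[R] H) x k₂) (gammaInv S' σ' k₁) := by
  induction x with
  | zero => simp [sw]
  | add x x' hx hx' => simp only [map_add, LinearMap.add_apply, hx, hx', sw_add_fun]
  | tmul b f =>
    rw [smashRep_tmul, hit_gammaInv, map_sw]
    simp [alphaMap]

/-- Multiplying `smashRep_gammaInv` by 1 # S' strips off γ'. Thus the values at γ' determine α(x).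
-/
theorem alphaMap_eq_smashRep (hS' : IsTwistedAntipode S') (hσ : IsCrossedProduct act σ σ')
    (x : (A ⊗[R] H) ⊗[R] U.toSubmodule) (k : H) :
    alphaMap U.toSubmodule (A ⊗[R] H) x k = sw R k fun k₁ k₂ =>
      crossedMul act σ (smashRep act σ U x (gammaInv S' σ' k₂)) ((1 : A) ⊗ₜ[R] S' k₁) := by
  have h (k₂ : H) : smashRep act σ U x (gammaInv S' σ' k₂) = _ := smashRep_gammaInv x k₂
  simp only [h, map_sw, sw_apply, crossedMul_assoc hσ]
  rw [← sw_coassoc R k fun k₁ k₂ k₃ => crossedMul act σ (alphaMap U.toSubmodule (A ⊗[R] H) x k₃)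
    (crossedMul act σ (gammaInv S' σ' k₂) ((1 : A) ⊗ₜ[R] S' k₁))]
  simp only [← map_sw, gammaInv_mul hS' hσ, map_smul, hσ.mul_one]
  rw [sw_counit_left R k fun k => alphaMap U.toSubmodule (A ⊗[R] H) x k]

variable (act σ σ' S') in
/-- `a ⊗ k ↦ γ'(k) a`. -/
def theta : A ⊗[R] H →ₗ[R] A ⊗[R] H :=
  TensorProduct.lift (((crossedMul act σ).compl₁₂ (gammaInv S' σ')
    ((TensorProduct.mk R A H).flip 1)).flip)

@[simp]
theorem theta_tmul (a : A) (k : H) :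
    theta act σ σ' S' (a ⊗ₜ k) = crossedMul act σ (gammaInv S' σ' k) (a ⊗ₜ 1) := rfl

theorem theta_mul_tmul_one (hσ : IsCrossedProduct act σ σ') (x : A ⊗[R] H) (a : A) :
    theta act σ σ' S' (x * (a ⊗ₜ 1)) = crossedMul act σ (theta act σ σ' S' x) (a ⊗ₜ 1) := by
  induction x with
  | zero => simp
  | add x x' hx hx' => simp only [map_add, LinearMap.add_apply, hx, hx', add_mul]
  | tmul b f =>
    rw [Algebra.TensorProduct.tmul_mul_tmul, theta_tmul, theta_tmul, crossedMul_assoc hσ,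
      crossedMul_tmul_one hσ, Algebra.TensorProduct.tmul_mul_tmul, mul_one, mul_one]

/-- A left inverse exists. The coaction of Θ(a ⊗ k) is ∑ Θ(a ⊗ k₁) ⊗ k₂; multiplying on the left by
1 # S'(k₂) leaves ε(k)a # 1. Doing this on the first leg of one further coaction gives ∑ ε(k₁)a ⊗ k₂
= a ⊗ k. -/
theorem theta_injective (hS' : IsTwistedAntipode S') (hσ : IsCrossedProduct act σ σ') :
    Function.Injective (theta act σ σ' S') := by
  let K : (A ⊗[R] H) ⊗[R] H →ₗ[R] A ⊗[R] H :=
    TensorProduct.lift ((crossedMul act σ ∘ₗ TensorProduct.mk R A H 1 ∘ₗ S').flip)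
  have hc (a : A) (k : H) : crossedCoact (theta act σ σ' S' (a ⊗ₜ k)) =
      sw R k fun x y => theta act σ σ' S' (a ⊗ₜ x) ⊗ₜ[R] y := by
    rw [theta_tmul, crossedCoact_crossedMul, crossedCoact_gammaInv, crossedCoact_tmul_one]
    simp only [map_sw, sw_apply, TensorProduct.map₂_apply_tmul, TensorProduct.map_tmul,
      LinearMap.mul_apply', mul_one, theta_tmul]
  have hK (a : A) (k : H) : K (crossedCoact (theta act σ σ' S' (a ⊗ₜ k))) =
      counit (R := R) k • (a ⊗ₜ[R] (1 : H)) := by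
    rw [hc, map_sw]
    change (sw R k fun x y => crossedMul act σ ((1 : A) ⊗ₜ[R] S' y)
      (crossedMul act σ (gammaInv S' σ' x) (a ⊗ₜ 1))) = _
    simp only [← crossedMul_assoc hσ]
    rw [← sw_apply, ← map_sw, mul_gammaInv hS' hσ, map_smul, LinearMap.smul_apply, hσ.one_mul]
  let J : A ⊗[R] H →ₗ[R] A ⊗[R] H :=
    (counitCoeff R H A ∘ₗ K ∘ₗ crossedCoact).rTensor H ∘ₗ crossedCoact
  have hJ : J ∘ₗ theta act σ σ' S' = .id := by
    refine TensorProduct.ext' fun a k => ?_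
    simp only [J, LinearMap.comp_apply]
    rw [hc]
    simp only [map_sw, LinearMap.rTensor_tmul, LinearMap.comp_apply, hK, map_smul,
      counitCoeff_tmul, Bialgebra.counit_one, one_smul, ← TensorProduct.smul_tmul']
    exact sw_counit_left R k fun k => a ⊗ₜ[R] k
  exact Function.LeftInverse.injective (g := J) fun x => LinearMap.congr_fun hJ x

/-! ### The algebra generated by `H` and `U` on `H` -/

variable (U) in
/-- `h ⊗ f ↦ (k ↦ h (f ⇀ k))`. -/
def hitRep : H ⊗[R] U.toSubmodule →ₗ[R] Module.End R H :=
  TensorProduct.lift <| LinearMap.mk₂ R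
    (fun h f => LinearMap.mulLeft R h ∘ₗ leftHit (f : Module.Dual R H))
    (fun h h' f => by ext; simp [add_mul])
    (fun c h f => by ext; simp)
    (fun h f f' => by ext; simp [leftHit_apply, add_smul, sw_add_fun, mul_add])
    (fun c h f => by ext; simp [leftHit_apply, mul_smul, ← smul_sw])

@[simp]
theorem hitRep_tmul (h : H) (f : U.toSubmodule) (k : H) :
    hitRep U (h ⊗ₜ f) k = h * leftHit (f : Module.Dual R H) k := rfl

theorem hitRep_mul_mem (x y : H ⊗[R] U.toSubmodule) :
    hitRep U x * hitRep U y ∈ LinearMap.range (hitRep U) := by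
  induction x with
  | zero => simp
  | add x x' hx hx' => simpa only [map_add, add_mul] using add_mem hx hx'
  | tmul h f =>
  induction y with
  | zero => simp
  | add y y' hy hy' => simpa only [map_add, mul_add] using add_mem hy hy'
  | tmul l g =>
    refine ⟨sw R l fun x y => (h * x) ⊗ₜ U.mul (U.act f y) g, LinearMap.ext fun k => ?_⟩
    rw [map_sw, sw_apply, Module.End.mul_apply, hitRep_tmul, hitRep_tmul, leftHit_mul, mul_sw]
    refine sw_congr fun x y => ?_
    rw [hitRep_tmul, mul_assoc, ← leftHit_conv]
    rfl

variable (U) in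
/-- The subalgebra `H # U` of `End_R(H)`. -/
def hitAlgebra : NonUnitalSubalgebra R (Module.End R H) where
  __ := LinearMap.range (hitRep U)
  mul_mem' := by
    rintro _ _ ⟨x, rfl⟩ ⟨y, rfl⟩
    exact hitRep_mul_mem x y

variable (U) in
/-- `A ⊗ (H # U) → End_R(A ⊗ H)`. -/
def tensorRep (A : Type w) [Ring A] [Algebra R A] :
    A ⊗[R] hitAlgebra U →ₗ[R] Module.End R (A ⊗[R] H) :=
  TensorProduct.homTensorHomMap (.id R) A H A H ∘ₗ
    TensorProduct.map (LinearMap.mul R A) (hitAlgebra U).toSubmodule.subtype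

@[simp]
theorem tensorRep_tmul (a b : A) (T : hitAlgebra U) (k : H) :
    tensorRep U A (a ⊗ₜ T) (b ⊗ₜ k) = (a * b) ⊗ₜ (T : Module.End R H) k := rfl

theorem tensorRep_mul (x y : A ⊗[R] hitAlgebra U) :
    tensorRep U A (x * y) = tensorRep U A x * tensorRep U A y := by
  induction x with
  | zero => simp
  | add x x' hx hx' => simp only [map_add, hx, hx', add_mul]
  | tmul a T =>
  induction y with
  | zero => simp
  | add y y' hy hy' => simp only [map_add, hy, hy', mul_add]
  | tmul b T' =>
    rw [Algebra.TensorProduct.tmul_mul_tmul]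
    refine TensorProduct.ext' fun c k => ?_
    simp [mul_assoc]

theorem tensorRep_mul_tmul_one (z : A ⊗[R] hitAlgebra U) (x : A ⊗[R] H) (a : A) :
    tensorRep U A z (x * (a ⊗ₜ 1)) = tensorRep U A z x * (a ⊗ₜ 1) := by
  induction z with
  | zero => simp
  | add x x' hx hx' => simp only [map_add, LinearMap.add_apply, hx, hx', add_mul]
  | tmul b T =>
  induction x with
  | zero => simp
  | add y y' hy hy' => simp only [map_add, hy, hy', add_mul]
  | tmul c k => simp [mul_assoc]

variable (A U) in
/-- `(a ⊗ h) ⊗ f ↦ a ⊗ h f`. -/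
def toTensorHit : (A ⊗[R] H) ⊗[R] U.toSubmodule →ₗ[R] A ⊗[R] hitAlgebra U :=
  ((hitRep U).rangeRestrict : H ⊗[R] U.toSubmodule →ₗ[R] hitAlgebra U).lTensor A ∘ₗ
    (TensorProduct.assoc R A H U.toSubmodule).toLinearMap

theorem toTensorHit_surjective : Function.Surjective (toTensorHit A U) :=
  (LinearMap.lTensor_surjective A (LinearMap.surjective_rangeRestrict (hitRep U))).comp
    (LinearEquiv.surjective _)

variable (A U) in
/-- `(a ⊗ h) ⊗ f ↦ (k ↦ a ⊗ h (f ⇀ k))`. -/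
def evalHit : (A ⊗[R] H) ⊗[R] U.toSubmodule →ₗ[R] H →ₗ[R] A ⊗[R] H :=
  (LinearMap.lcomp R (A ⊗[R] H) (TensorProduct.mk R A H 1)) ∘ₗ tensorRep U A ∘ₗ toTensorHit A U

theorem evalHit_apply (t : (A ⊗[R] H) ⊗[R] U.toSubmodule) (k : H) :
    evalHit A U t k = tensorRep U A (toTensorHit A U t) (1 ⊗ₜ k) := rfl

@[simp]
theorem evalHit_tmul (a : A) (h : H) (f : U.toSubmodule) (k : H) :
    evalHit A U ((a ⊗ₜ h) ⊗ₜ f) k = a ⊗ₜ (h * leftHit (f : Module.Dual R H) k) := by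
  change (a * 1) ⊗ₜ[R] _ = _
  rw [mul_one]
  rfl

/-- In ∑ h k₂S'(k₁) f(k₃) the factor k₂S'(k₁) collapses to a counit. Hence α factors through
evaluation at 1 ⊗ k, and its injectivity passes to the action of A ⊗ L. -/
theorem alphaMap_eq_evalHit (hS' : IsTwistedAntipode S') (t : (A ⊗[R] H) ⊗[R] U.toSubmodule)
    (k : H) : alphaMap U.toSubmodule (A ⊗[R] H) t k =
      sw R k fun k₁ k₂ => evalHit A U t k₂ * (1 ⊗ₜ S' k₁) := by
  induction t with
  | zero => simp [sw]
  | add x x' hx hx' => simp only [map_add, LinearMap.add_apply, hx, hx', sw_add_fun, add_mul]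
  | tmul b f =>
  induction b with
  | zero => simp [sw]
  | add x x' hx hx' =>
    simp only [map_add, LinearMap.add_apply, hx, hx', sw_add_fun, add_mul, TensorProduct.add_tmul]
  | tmul a h =>
    simp only [evalHit_tmul, Algebra.TensorProduct.tmul_mul_tmul, mul_one, leftHit_apply, mul_sw,
      sw_mul_right, tmul_sw]
    rw [← sw_coassoc R k fun k₁ k₂ k₃ => a ⊗ₜ[R] (h * (f : Module.Dual R H) k₃ • k₂ * S' k₁)]
    simp only [mul_smul_comm, smul_mul_assoc, TensorProduct.tmul_smul, mul_assoc, ← smul_sw,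
      ← tmul_sw, ← mul_sw, hS'.sw_right, mul_one]
    simp only [smul_comm _ (counit (R := R) _)]
    rw [sw_counit_left R k fun k => (f : Module.Dual R H) k • a ⊗ₜ[R] h]
    simp [alphaMap]

theorem exists_evalHit_mul (t : (A ⊗[R] H) ⊗[R] U.toSubmodule) (h : H) :
    ∃ t' : (A ⊗[R] H) ⊗[R] U.toSubmodule, ∀ k, evalHit A U t (h * k) = evalHit A U t' k := by
  induction t with
  | zero => exact ⟨0, by simp⟩
  | add x x' hx hx' =>
    obtain ⟨t, ht⟩ := hx
    obtain ⟨t', ht'⟩ := hx'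
    exact ⟨t + t', fun k => by simp [ht, ht']⟩
  | tmul b f =>
  induction b with
  | zero => exact ⟨0, by simp⟩
  | add x x' hx hx' =>
    obtain ⟨t, ht⟩ := hx
    obtain ⟨t', ht'⟩ := hx'
    exact ⟨t + t', fun k => by simp [ht, ht', TensorProduct.add_tmul]⟩
  | tmul a l =>
    refine ⟨sw R h fun x y => (a ⊗ₜ (l * x)) ⊗ₜ U.act f y, fun k => ?_⟩
    rw [map_sw, sw_apply, evalHit_tmul, leftHit_mul, mul_sw, tmul_sw]
    refine sw_congr fun x y => ?_
    rw [evalHit_tmul, mul_assoc]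
    rfl

/-- With `smashRep_hit`, this reduces the comparison for (a # h) # f to the factor a # h, although U
may have no unit. -/
theorem evalHit_leftHit (t : (A ⊗[R] H) ⊗[R] U.toSubmodule) (f : U.toSubmodule) (k : H) :
    evalHit A U t (leftHit (f : Module.Dual R H) k) =
      evalHit A U ((U.mul.flip f).lTensor _ t) k := by
  induction t with
  | zero => simp
  | add x x' hx hx' => simp only [map_add, LinearMap.add_apply, hx, hx']
  | tmul b g =>
  induction b with
  | zero => simp
  | add x x' hx hx' => simp only [map_add, LinearMap.add_apply, hx, hx', TensorProduct.add_tmul]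
  | tmul a h =>
    rw [LinearMap.lTensor_tmul, evalHit_tmul, evalHit_tmul, ← leftHit_conv]
    rfl

theorem smashRep_hit (x : (A ⊗[R] H) ⊗[R] U.toSubmodule) (f : U.toSubmodule) (c : A ⊗[R] H) :
    smashRep act σ U x (hit A (f : Module.Dual R H) c) =
      smashRep act σ U ((U.mul.flip f).lTensor _ x) c := by
  induction x with
  | zero => simp
  | add x x' hx hx' => simp only [map_add, LinearMap.add_apply, hx, hx']
  | tmul b g =>
    rw [LinearMap.lTensor_tmul, smashRep_tmul, smashRep_tmul, ← hit_conv]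
    rfl

end Operators

/-! ### The functions φ and ψ as coefficients of products -/

section Duality

variable {R : Type u} [CommRing R] {H : Type v} [Ring H] [Bialgebra R H]
  {A : Type w} [Ring A] [Algebra R A]
  {act : H →ₗ[R] A →ₗ[R] A} {σ σ' : H ⊗[R] H →ₗ[R] A} {S' : H →ₗ[R] H}
  {U : RightModuleSubalgebra R H}

theorem phi_apply (h : H) (a : A) (k : H) : phi S' act σ h a k =
    sw R k fun x y => act (S' y) a * σ (S' x ⊗ₜ h) := by
  simp [phi, comul_eq_sw, map_sw]

theorem psi_apply (h : H) (a : A) (k : H) : psi S' act σ σ' h a k =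
    sw R k fun x u => sw R u fun y z =>
      (sw R y fun y₁ y₂ => twist S' σ' y₁ * act y₂ a) * σ (z ⊗ₜ (S' x * h)) := by
  have e (y : H) : (LinearMap.mul' R A ∘ₗ TensorProduct.map (twist S' σ') (act.flip a) ∘ₗ comul) y =
      sw R y fun y₁ y₂ => twist S' σ' y₁ * act y₂ a := by
    simp [comul_eq_sw, map_sw]
  simp only [← e, psi]
  simp only [comul_eq_sw, map_sw, LinearMap.comp_apply, LinearMap.lTensor_tmul, tmul_sw,
    LinearEquiv.coe_coe, TensorProduct.leftComm_tmul, TensorProduct.map_tmul,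
    TensorProduct.comm_tmul, LinearMap.mul'_apply, LinearMap.mulRight_apply]
  simp [twist, comul_eq_sw, map_sw]

@[simp]
theorem phi_add (h h' : H) (a : A) :
    phi S' act σ (h + h') a = phi S' act σ h a + phi S' act σ h' a := by
  ext k
  simp [phi_apply, TensorProduct.tmul_add, mul_add, sw_add_fun]

@[simp]
theorem phi_smul (r : R) (h : H) (a : A) : phi S' act σ (r • h) a = r • phi S' act σ h a := by
  ext k
  simp [phi_apply, ← smul_sw]

/-- This is where φ comes from; with `crossedMul_eq_map₂` the whole product can be rebuilt from it.
`psi_eq` plays the same role for γ'. -/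
theorem phi_eq (hS' : IsTwistedAntipode S') (h : H) (a : A) (k : H) :
    phi S' act σ h a k = counitCoeff R H A (crossedMul act σ ((1 : A) ⊗ₜ S' k) (a ⊗ₜ h)) := by
  rw [phi_apply, counitCoeff_crossedMul_tmul, hS'.sw_apply]
  · simp only [one_mul]
  · constructor <;> intros <;> simp [add_mul, mul_add, TensorProduct.add_tmul,
      ← TensorProduct.smul_tmul']

theorem psi_eq (h : H) (a : A) (k : H) : psi S' act σ σ' h a k = sw R k fun x y =>
    counitCoeff R H A (crossedMul act σ (gammaInv S' σ' y) (a ⊗ₜ (S' x * h))) := by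
  rw [psi_apply]
  refine sw_congr fun x u => ?_
  simp only [sw_mul_right]
  rw [sw_coassoc R u fun y₁ y₂ z => twist S' σ' y₁ * act y₂ a * σ (z ⊗ₜ (S' x * h))]
  simp only [gammaInv_apply, map_sw, sw_apply, counitCoeff_crossedMul_tmul]

@[simp]
theorem psi_add (h h' : H) (a : A) :
    psi S' act σ σ' (h + h') a = psi S' act σ σ' h a + psi S' act σ σ' h' a := by
  ext k
  simp [psi_eq, TensorProduct.tmul_add, mul_add, sw_add_fun]

@[simp]
theorem psi_smul (r : R) (h : H) (a : A) :
    psi S' act σ σ' (r • h) a = r • psi S' act σ σ' h a := by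
  ext k
  simp [psi_eq, ← smul_sw]

theorem antipode_crossedMul_tmul (hS' : IsTwistedAntipode S') (a : A) (h l : H) :
    crossedMul act σ ((1 : A) ⊗ₜ S' l) (a ⊗ₜ h) = sw R h fun h₁ h₂ => sw R l fun l₁ l₂ =>
      phi S' act σ h₁ a l₂ ⊗ₜ[R] (S' l₁ * h₂) := by
  rw [crossedMul_eq_map₂, crossedCoact_antipode hS', crossedCoact_tmul]
  simp only [map_sw, sw_apply, TensorProduct.map₂_apply_tmul, LinearMap.compr₂_apply,
    LinearMap.mul_apply', TensorProduct.map_tmul, ← phi_eq hS']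

theorem gammaInv_crossedMul_tmul (hS' : IsTwistedAntipode S') (a : A) (h l : H) :
    (sw R l fun l₁ l₂ => crossedMul act σ (gammaInv S' σ' l₂) (a ⊗ₜ (S' l₁ * h))) =
      sw R h fun h₁ h₂ => sw R l fun l₁ u => sw R u fun l₂ l₃ =>
        psi S' act σ σ' h₁ a l₂ ⊗ₜ[R] (l₃ * (S' l₁ * h₂)) := by
  have e1 (l₁ l' : H) : crossedMul act σ (gammaInv S' σ' l') (a ⊗ₜ (S' l₁ * h)) =
      sw R l₁ fun p₁ p₂ => sw R l' fun x y => sw R h fun h₁ h₂ => counitCoeff R H A (crossedMul act σ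
      (gammaInv S' σ' x) (a ⊗ₜ (S' p₂ * h₁))) ⊗ₜ[R] (y * (S' p₁ * h₂)) := by
    have hb : IsBilin R fun p q : H => sw R l' fun x y => counitCoeff R H A (crossedMul act σ
        (gammaInv S' σ' x) (a ⊗ₜ p)) ⊗ₜ[R] (y * q) := by
      constructor <;> intros <;> simp [TensorProduct.add_tmul, TensorProduct.tmul_add, mul_add,
        ← TensorProduct.smul_tmul', sw_add_fun, ← smul_sw]
    rw [crossedMul_eq_map₂, crossedCoact_gammaInv, crossedCoact_tmul]
    simp only [map_sw, sw_apply, TensorProduct.map₂_apply_tmul, LinearMap.compr₂_apply,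
      LinearMap.mul_apply', TensorProduct.map_tmul]
    rw [sw_mul hb, hS'.sw_apply]
    · exact sw_congr fun p₁ p₂ => sw_comm _ _ _
    · constructor <;> intros <;> simp [TensorProduct.add_tmul, TensorProduct.tmul_add, mul_add,
        add_mul, ← TensorProduct.smul_tmul', sw_add_fun, ← smul_sw]
  simp only [e1, psi_eq, sw_tmul]
  rw [sw_coassoc R l fun p₁ p₂ l' => sw R l' fun x y => sw R h fun h₁ h₂ => counitCoeff R H A (crossedMul act σ
      (gammaInv S' σ' x) (a ⊗ₜ (S' p₂ * h₁))) ⊗ₜ[R] (y * (S' p₁ * h₂)), sw_comm h]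
  refine sw_congr fun p₁ u => ?_
  simp only [sw_comm (R := R) (C := H) (D := H) h]
  exact (sw_coassoc R u fun p₂ x y => sw R h fun h₁ h₂ => counitCoeff R H A (crossedMul act σ
      (gammaInv S' σ' x) (a ⊗ₜ (S' p₂ * h₁))) ⊗ₜ[R] (y * (S' p₁ * h₂))).symm

/-- `∑ F(S'((h₂ k)₁) h₁, (h₂ k)₂) = ∑ F(S'(k₁), h k₂)`. -/
theorem IsTwistedAntipode.sw_mul_comul (hS' : IsTwistedAntipode S') {P : Type*} [AddCommMonoid P]
    [Module R P] {F : H → H → P} (hF : IsBilin R F) (h k : H) :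
    (sw R h fun h₁ h₂ => sw R (h₂ * k) fun l₁ l₂ => F (S' l₁ * h₁) l₂) =
      sw R k fun k₁ k₂ => F (S' k₁) (h * k₂) := by
  obtain ⟨β, hβ⟩ : ∃ β : H →ₗ[R] H →ₗ[R] P, F = fun x y => β x y := ⟨hF.toLinearMap, rfl⟩
  subst hβ
  calc _ = sw R h fun h₁ t => sw R t fun p q => sw R k fun k₁ k₂ =>
        β (S' (p * k₁) * h₁) (q * k₂) := by
        refine sw_congr fun h₁ t => ?_
        rw [sw_mul]
        constructor <;> intros <;> simp [add_mul]
    _ = sw R h fun t q => sw R t fun h₁ p => sw R k fun k₁ k₂ =>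
        β (S' (p * k₁) * h₁) (q * k₂) :=
        (sw_coassoc R h fun h₁ p q => sw R k fun k₁ k₂ => β (S' (p * k₁) * h₁) (q * k₂)).symm
    _ = sw R h fun t q => counit (R := R) t • sw R k fun k₁ k₂ => β (S' k₁) (q * k₂) := by
        refine sw_congr fun t q => ?_
        rw [sw_comm, smul_sw]
        refine sw_congr fun k₁ k₂ => ?_
        have e := congrArg (β.flip (q * k₂)) (hS'.sw_mul_cancel t k₁)
        simpa only [map_sw, map_smul, LinearMap.flip_apply] using e
    _ = _ := sw_counit_left R h fun q => sw R k fun k₁ k₂ => β (S' k₁) (q * k₂)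

theorem sw_antipode_crossedMul (hS' : IsTwistedAntipode S') (a : A) (h k : H) :
    (sw R h fun h₁ h₂ => crossedMul act σ ((1 : A) ⊗ₜ S' (h₂ * k)) (a ⊗ₜ h₁)) =
      sw R h fun h₁ h₂ => sw R k fun k₁ k₂ => phi S' act σ h₁ a (h₂ * k₂) ⊗ₜ[R] S' k₁ := by
  simp only [antipode_crossedMul_tmul hS']
  rw [sw_coassoc R h fun x y z => sw R (z * k) fun l₁ l₂ =>
    phi S' act σ x a l₂ ⊗ₜ[R] (S' l₁ * y)]
  refine sw_congr fun x y => ?_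
  refine hS'.sw_mul_comul (F := fun u l => phi S' act σ x a l ⊗ₜ[R] u) ?_ y k
  constructor <;> intros <;> simp [TensorProduct.add_tmul, TensorProduct.tmul_add,
      ← TensorProduct.smul_tmul']

/-- By `sw_antipode_crossedMul` the left part ends in 1 # S', which cancels the adjacent γ' and
leaves an element of A. -/
theorem sw_antipode_crossedMul_gammaInv (hS' : IsTwistedAntipode S')
    (hσ : IsCrossedProduct act σ σ') (a : A) (h k : H) :
    (sw R h fun h₁ h₂ => sw R k fun k₁ k₂ => crossedMul act σ ((1 : A) ⊗ₜ S' (h₂ * k₂))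
      (crossedMul act σ (a ⊗ₜ h₁) (gammaInv S' σ' k₁))) =
      sw R h fun h₁ h₂ => phi S' act σ h₁ a (h₂ * k) ⊗ₜ[R] (1 : H) := by
  have e (c : A) (l : H) : c ⊗ₜ[R] l = (c ⊗ₜ 1) * (1 ⊗ₜ l) := by
    rw [Algebra.TensorProduct.tmul_mul_tmul, mul_one, one_mul]
  simp only [← crossedMul_assoc hσ]
  rw [sw_comm]
  simp only [← sw_apply, ← map_sw, sw_antipode_crossedMul hS']
  simp only [sw_apply, map_sw]
  rw [sw_comm k]
  refine sw_congr fun x y => ?_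
  rw [← sw_coassoc R k fun z p q => crossedMul act σ (phi S' act σ x a (y * q) ⊗ₜ S' p)
    (gammaInv S' σ' z), ← sw_counit_left R k fun q => phi S' act σ x a (y * q) ⊗ₜ[R] (1 : H)]
  refine sw_congr fun u q => ?_
  simp only [e (phi S' act σ x a (y * q)) (S' _), crossedMul_left, ← mul_sw]
  rw [mul_gammaInv hS' hσ, mul_smul_comm, Algebra.TensorProduct.tmul_mul_tmul, mul_one, mul_one]

/-- `(a # h) γ'(k) = ∑ γ'(h₃ k₂) φ(h₁ ⊗ a)(h₂ k₁)`. -/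
theorem crossedMul_gammaInv (hS' : IsTwistedAntipode S') (hσ : IsCrossedProduct act σ σ')
    (a : A) (h k : H) : crossedMul act σ (a ⊗ₜ h) (gammaInv S' σ' k) =
      sw R h fun h₁ u => theta act σ σ' S'
        (sw R (u * k) fun l₁ l₂ => phi S' act σ h₁ a l₁ ⊗ₜ[R] l₂) := by
  -- Insert ε(h₂k₂) in the form ∑ γ'(l₂)(1 # S'(l₁)) with l = h₂k₂. The part to the right of γ' then
  -- becomes an element of A.
  calc _ = sw R h fun h₁ u => sw R k fun k₁ r => sw R (u * r) fun l₁ l₂ =>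
        crossedMul act σ (gammaInv S' σ' l₂) (crossedMul act σ ((1 : A) ⊗ₜ S' l₁)
          (crossedMul act σ (a ⊗ₜ h₁) (gammaInv S' σ' k₁))) := by
        simp only [← crossedMul_assoc hσ]
        simp only [← sw_apply, ← map_sw, gammaInv_mul hS' hσ]
        simp only [map_smul, LinearMap.smul_apply, hσ.one_mul, Bialgebra.counit_mul, mul_smul,
          ← smul_sw]
        have hc (h₁ : H) := sw_counit_right R k fun k =>
          crossedMul act σ (a ⊗ₜ h₁) (gammaInv S' σ' k)
        simp only [hc]
        rw [sw_counit_right R h fun h => crossedMul act σ (a ⊗ₜ h) (gammaInv S' σ' k)]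
    _ = sw R h fun h₁ u => sw R k fun k₁ r => sw R u fun h₂ h₃ => sw R r fun k₂ k₃ =>
        crossedMul act σ (gammaInv S' σ' (h₃ * k₃)) (crossedMul act σ ((1 : A) ⊗ₜ S' (h₂ * k₂))
          (crossedMul act σ (a ⊗ₜ h₁) (gammaInv S' σ' k₁))) := by
        refine sw_congr fun h₁ u => sw_congr fun k₁ r => ?_
        rw [sw_mul]
        constructor <;> intros <;> simp [TensorProduct.tmul_add]
    _ = sw R h fun t h₃ => sw R k fun r k₃ => sw R t fun h₁ h₂ => sw R r fun k₁ k₂ =>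
        crossedMul act σ (gammaInv S' σ' (h₃ * k₃)) (crossedMul act σ ((1 : A) ⊗ₜ S' (h₂ * k₂))
          (crossedMul act σ (a ⊗ₜ h₁) (gammaInv S' σ' k₁))) := by
        refine Eq.trans ?_ (sw_congr fun t h₃ => sw_comm _ _ _)
        refine Eq.trans ?_ (sw_coassoc R h fun h₁ h₂ h₃ => sw R k fun r k₃ => sw R r fun k₁ k₂ =>
          crossedMul act σ (gammaInv S' σ' (h₃ * k₃)) (crossedMul act σ
            ((1 : A) ⊗ₜ S' (h₂ * k₂)) (crossedMul act σ (a ⊗ₜ h₁) (gammaInv S' σ' k₁)))).symm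
        refine sw_congr fun h₁ u => ?_
        rw [sw_comm]
        refine sw_congr fun h₂ h₃ => ?_
        exact (sw_coassoc R k fun k₁ k₂ k₃ =>
          crossedMul act σ (gammaInv S' σ' (h₃ * k₃)) (crossedMul act σ
            ((1 : A) ⊗ₜ S' (h₂ * k₂)) (crossedMul act σ (a ⊗ₜ h₁) (gammaInv S' σ' k₁)))).symm
    _ = sw R h fun t h₃ => sw R k fun r k₃ => sw R t fun h₁ h₂ =>
        crossedMul act σ (gammaInv S' σ' (h₃ * k₃)) (phi S' act σ h₁ a (h₂ * r) ⊗ₜ[R] (1 : H)) := by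
        refine sw_congr fun t h₃ => sw_congr fun r k₃ => ?_
        simp only [← map_sw, sw_antipode_crossedMul_gammaInv hS' hσ]
    _ = _ := by
        have hb (h₁ : H) : IsBilin R fun l₁ l₂ : H =>
            crossedMul act σ (gammaInv S' σ' l₂) (phi S' act σ h₁ a l₁ ⊗ₜ (1 : H)) := by
          constructor <;> intros <;> simp [TensorProduct.add_tmul, ← TensorProduct.smul_tmul']
        simp only [map_sw, theta_tmul, sw_mul (hb _)]
        rw [← sw_coassoc R h fun h₁ h₂ h₃ => sw R k fun r k₃ =>
          crossedMul act σ (gammaInv S' σ' (h₃ * k₃)) (phi S' act σ h₁ a (h₂ * r) ⊗ₜ[R] (1 : H))]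
        exact sw_congr fun t h₃ => sw_comm _ _ _

end Duality

/-! ### Equality of the two operator spaces, density, and the isomorphism -/

section Isomorphism

variable {R : Type u} [CommRing R] {H : Type v} [Ring H] [Bialgebra R H]
  {A : Type w} [Ring A] [Algebra R A]
  {act : H →ₗ[R] A →ₗ[R] A} {σ σ' : H ⊗[R] H →ₗ[R] A} {S' : H →ₗ[R] H}
  {U : RightModuleSubalgebra R H}

/-- For F = g(·)a with g ∈ V the sum is a ⊗ (l ↼ g), which the RL-condition rewrites as ∑ a ⊗
h_j(g_j ⇀ l). -/
theorem RLCondition.exists_evalHit {V : Submodule R (Module.Dual R H)}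
    (h : RLCondition V U.toSubmodule) (F : H →ₗ[R] A) (hF : F ∈ LinearMap.range (alphaMap V A)) :
    ∃ t : (A ⊗[R] H) ⊗[R] U.toSubmodule, ∀ l : H,
      (sw R l fun x y => F x ⊗ₜ[R] y) = evalHit A U t l := by
  obtain ⟨z, rfl⟩ := hF
  induction z with
  | zero => exact ⟨0, fun l => by simp [sw]⟩
  | add z z' hz hz' =>
    obtain ⟨t, ht⟩ := hz
    obtain ⟨t', ht'⟩ := hz'
    exact ⟨t + t', fun l => by
      simp only [map_add, LinearMap.add_apply, TensorProduct.add_tmul, sw_add_fun, ht, ht']⟩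
  | tmul a g =>
    obtain ⟨n, x, y, hxy⟩ := h g g.2
    refine ⟨∑ j, (a ⊗ₜ x j) ⊗ₜ y j, fun l => ?_⟩
    simp only [map_sum, LinearMap.sum_apply, evalHit_tmul, ← TensorProduct.tmul_sum, ← hxy,
      rightHit_apply, tmul_sw]
    refine sw_congr fun p q => ?_
    simp [alphaMap, ← TensorProduct.smul_tmul']

theorem exists_evalHit_eq_smashRep (hS' : IsTwistedAntipode S') (hσ : IsCrossedProduct act σ σ')
    {V : Submodule R (Module.Dual R H)} (hVU : IsCompatible S' act σ σ' V U.toSubmodule)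
    (x : (A ⊗[R] H) ⊗[R] U.toSubmodule) :
    ∃ t : (A ⊗[R] H) ⊗[R] U.toSubmodule, ∀ k, smashRep act σ U x (gammaInv S' σ' k) =
      theta act σ σ' S' (evalHit A U t k) := by
  induction x with
  | zero => exact ⟨0, fun l => by simp⟩
  | add z z' hz hz' =>
    obtain ⟨t, ht⟩ := hz
    obtain ⟨t', ht'⟩ := hz'
    exact ⟨t + t', fun l => by simp only [map_add, LinearMap.add_apply, ht, ht']⟩
  | tmul b f =>
  induction b with
  | zero => exact ⟨0, fun l => by simp⟩
  | add z z' hz hz' =>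
    obtain ⟨t, ht⟩ := hz
    obtain ⟨t', ht'⟩ := hz'
    exact ⟨t + t', fun l => by
      simp only [TensorProduct.add_tmul, map_add, LinearMap.add_apply, ht, ht']⟩
  | tmul a h =>
    -- The choices `t` and `t'` need not be linear: they are summed over the fixed representation of
    -- Δ(h), and no step requiring linearity is applied to them.
    choose t ht using fun h : H => hVU.rl.exists_evalHit _ (hVU.phi_mem h a)
    choose t' ht' using exists_evalHit_mul (A := A) (U := U)
    refine ⟨(U.mul.flip f).lTensor _ (sw R h fun h₁ h₂ => t' (t h₁) h₂), fun k => ?_⟩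
    rw [← evalHit_leftHit, map_sw, sw_apply, smashRep_tmul, hit_gammaInv, map_sw]
    simp only [← ht', map_smul, crossedMul_gammaInv hS' hσ, ht]
    simp only [← map_sw]
    simp only [leftHit_apply, mul_sw, map_sw, mul_smul_comm, map_smul, smul_sw]
    exact sw_comm _ _ _

theorem exists_smashRep_eq_evalHit (hS' : IsTwistedAntipode S') (hσ : IsCrossedProduct act σ σ')
    {V : Submodule R (Module.Dual R H)} (hVU : IsCompatible S' act σ σ' V U.toSubmodule)
    (t : (A ⊗[R] H) ⊗[R] U.toSubmodule) :
    ∃ x : (A ⊗[R] H) ⊗[R] U.toSubmodule, ∀ k, smashRep act σ U x (gammaInv S' σ' k) =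
      theta act σ σ' S' (evalHit A U t k) := by
  induction t with
  | zero => exact ⟨0, fun l => by simp⟩
  | add z z' hz hz' =>
    obtain ⟨t, ht⟩ := hz
    obtain ⟨t', ht'⟩ := hz'
    exact ⟨t + t', fun l => by simp only [map_add, LinearMap.add_apply, ht, ht']⟩
  | tmul b f =>
  induction b with
  | zero => exact ⟨0, fun l => by simp⟩
  | add z z' hz hz' =>
    obtain ⟨t, ht⟩ := hz
    obtain ⟨t', ht'⟩ := hz'
    exact ⟨t + t', fun l => by
      simp only [TensorProduct.add_tmul, map_add, LinearMap.add_apply, ht, ht']⟩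
  | tmul a h =>
    choose t ht using fun h : H => hVU.rl.exists_evalHit _ (hVU.psi_mem h a)
    choose t' ht' using exists_evalHit_mul (A := A) (U := U)
    let x := sw R h fun h₁ h₂ => t' (t h₁) h₂
    -- This element is built so that α(x) is the left-hand side. Rewriting that side by ψ uses
    -- `sw_mul_comul` twice, first to introduce h₂k and then to remove it.
    have h1 (k : H) : (sw R k fun k₁ k₂ => crossedMul act σ (gammaInv S' σ' (h * k₂))
        (a ⊗ₜ S' k₁)) = alphaMap U.toSubmodule (A ⊗[R] H) x k := by
      have hb (y : H) : IsBilin R fun u l : H =>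
          sw R l fun l₂ l₃ => psi S' act σ σ' y a l₂ ⊗ₜ[R] (l₃ * u) := by
        constructor <;> intros <;> simp [TensorProduct.add_tmul, TensorProduct.tmul_add, mul_add,
          ← TensorProduct.smul_tmul', sw_add_fun, ← smul_sw, add_mul, sw_add, sw_smul, isBilin_iff]
      calc _ = sw R h fun h₁ h₂ => sw R (h₂ * k) fun l₁ l₂ =>
            crossedMul act σ (gammaInv S' σ' l₂) (a ⊗ₜ (S' l₁ * h₁)) := by
            refine (hS'.sw_mul_comul (F := fun u l =>
              crossedMul act σ (gammaInv S' σ' l) (a ⊗ₜ u)) ?_ h k).symm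
            constructor <;> intros <;> simp [TensorProduct.tmul_add]
        _ = sw R h fun y v => sw R v fun z h₂ => sw R (h₂ * k) fun l₁ u => sw R u fun l₂ l₃ =>
            psi S' act σ σ' y a l₂ ⊗ₜ[R] (l₃ * (S' l₁ * z)) := by
            simp only [gammaInv_crossedMul_tmul hS']
            exact sw_coassoc R h fun y z h₂ => sw R (h₂ * k) fun l₁ u => sw R u fun l₂ l₃ =>
              psi S' act σ σ' y a l₂ ⊗ₜ[R] (l₃ * (S' l₁ * z))
        _ = sw R h fun y v => sw R k fun k₁ k₂ => sw R (v * k₂) fun l₂ l₃ =>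
            psi S' act σ σ' y a l₂ ⊗ₜ[R] (l₃ * S' k₁) :=
            sw_congr fun y v => hS'.sw_mul_comul (hb y) v k
        _ = _ := by
            simp only [x]
            rw [map_sw, sw_apply]
            simp only [alphaMap_eq_evalHit hS', ← ht', ← ht, sw_mul_right,
              Algebra.TensorProduct.tmul_mul_tmul, mul_one]
    -- Multiplying `h1` by γ' puts 1 # S'(k₂) next to γ'(k₁), and `mul_gammaInv` leaves γ'(hk)a.
    have h2 (k : H) : smashRep act σ U x (gammaInv S' σ' k) =
        theta act σ σ' S' (a ⊗ₜ (h * k)) := by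
      rw [smashRep_gammaInv]
      simp only [← h1, map_sw, sw_apply]
      have e (k : H) : a ⊗ₜ[R] S' k = crossedMul act σ (a ⊗ₜ 1) (1 ⊗ₜ S' k) := by
        rw [crossedMul_tmul_one hσ, Algebra.TensorProduct.tmul_mul_tmul, mul_one, one_mul]
      rw [← sw_coassoc R k fun z p q => crossedMul act σ (crossedMul act σ
        (gammaInv S' σ' (h * q)) (a ⊗ₜ[R] S' p)) (gammaInv S' σ' z), theta_tmul,
        ← sw_counit_left R k fun q => crossedMul act σ (gammaInv S' σ' (h * q)) (a ⊗ₜ 1)]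
      refine sw_congr fun u q => ?_
      simp only [e, crossedMul_assoc hσ, ← map_sw]
      rw [mul_gammaInv hS' hσ, map_smul, map_smul, hσ.mul_one]
    clear_value x
    refine ⟨(U.mul.flip f).lTensor _ x, fun k => ?_⟩
    rw [← smashRep_hit, hit_gammaInv, map_sw, evalHit_tmul, leftHit_apply, mul_sw, tmul_sw,
      map_sw (theta act σ σ' S')]
    refine sw_congr fun p q => ?_
    rw [map_smul, h2, mul_smul_comm, TensorProduct.tmul_smul, map_smul]

theorem hitAlgebra_dense [Module.Projective R H] (hS' : IsTwistedAntipode S')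
    (hU : IsDenseIn (U.toSubmodule : Set (Module.Dual R H)) Set.univ) :
    IsDenseIn (hitAlgebra U : Set (Module.End R H)) Set.univ := by
  classical
  rw [isDenseIn_iff] at hU ⊢
  refine ⟨Set.subset_univ _, fun T _ F => ?_⟩
  obtain ⟨s, hs⟩ := Module.projective_def'.1 (inferInstance : Module.Projective R H)
  -- Chosen so that ∑ G(k₂)k₁ = ∑ T(k₃)S'(k₂)k₁ = T(k).
  let G (u : H) : H := sw R u fun x y => T y * S' x
  have hG : IsLinearMap R G := by
    constructor <;> intros <;> simp [G, sw_add, sw_smul, isBilin_iff, add_mul, mul_add]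
  -- The approximating functionals are evaluated only at second legs of the k in `F`. Finitely many
  -- dual basis elements, collected in `E`, suffice to expand these legs.
  let F' : Finset H := F.biUnion fun k => (ℛ R k).index.image (ℛ R k).right
  let E : Finset H := F'.biUnion fun z => (s z).support
  choose f hf hfF using fun e : H => hU.2 (Finsupp.lapply e ∘ₗ s) trivial F'
  have hGF (z : H) (hz : z ∈ F') : ∑ e ∈ E, f e z • G e = G z := by
    have h1 : z = ∑ e ∈ E, s z e • e := by
      conv_lhs => rw [show z = Finsupp.linearCombination R id (s z) from
        (LinearMap.congr_fun hs z).symm]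
      rw [Finsupp.linearCombination_apply]
      exact Finsupp.sum_of_support_subset _ (Finset.subset_biUnion_of_mem (fun z => (s z).support) hz) _
        (by simp)
    conv_rhs => rw [h1]
    change _ = hG.mk' _ (∑ e ∈ E, s z e • e)
    rw [map_sum]
    refine Finset.sum_congr rfl fun e _ => ?_
    rw [hfF e z hz, map_smul]
    rfl
  refine ⟨hitRep U (∑ e ∈ E, G e ⊗ₜ ⟨f e, hf e⟩), ⟨_, rfl⟩, fun k hk => ?_⟩
  calc _ = sw R k fun x y => (∑ e ∈ E, f e y • G e) * x := by
        simp only [map_sum, LinearMap.sum_apply, hitRep_tmul, leftHit_apply, sw,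
          Finset.sum_mul]
        rw [Finset.sum_comm]
        simp only [mul_smul_comm, smul_mul_assoc, Finset.mul_sum]
    _ = sw R k fun x y => G y * x := by
        refine Finset.sum_congr rfl fun i hi => ?_
        beta_reduce
        rw [hGF _ (Finset.mem_biUnion.2 ⟨k, hk, Finset.mem_image_of_mem _ hi⟩)]
    _ = T k := by
        simp only [G, sw_mul_right]
        rw [← sw_coassoc R k fun x y z => T z * S' y * x]
        simp only [mul_assoc, ← mul_sw, hS'.sw_left]
        simpa using sw_counit_left R k fun z => T z

theorem hasDenseDuality [Module.Projective R H] (hS' : IsTwistedAntipode S')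
    (hσ : IsCrossedProduct act σ σ')
    {V : Submodule R (Module.Dual R H)} (hVU : IsCompatible S' act σ σ' V U.toSubmodule)
    (hU : IsDenseIn (U.toSubmodule : Set (Module.Dual R H)) Set.univ)
    (hα : Function.Injective (alphaMap U.toSubmodule (A ⊗[R] H))) : HasDenseDuality act σ U := by
  refine ⟨hitAlgebra U, hitAlgebra_dense hS' hU, ?_⟩
  let Θ := theta act σ σ' S'
  have hΘ : Function.Injective Θ := theta_injective hS' hσ
  let p : (A ⊗[R] H) ⊗[R] U.toSubmodule →ₗ[R] A ⊗[R] H →ₗ[R] A ⊗[R] H :=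
    LinearMap.lcomp R _ Θ ∘ₗ smashRep act σ U
  let q : A ⊗[R] hitAlgebra U →ₗ[R] A ⊗[R] H →ₗ[R] A ⊗[R] H :=
    LinearMap.llcomp R _ _ _ Θ ∘ₗ tensorRep U A
  have hpa (x) (c : A ⊗[R] H) : p x c = smashRep act σ U x (Θ c) := rfl
  have hqa (z) (c : A ⊗[R] H) : q z c = Θ (tensorRep U A z c) := rfl
  have hΘ1 (k : H) : Θ (1 ⊗ₜ k) = gammaInv S' σ' k := by
    rw [theta_tmul, hσ.mul_one]
  have hpinj : Function.Injective p := by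
    refine (injective_iff_map_eq_zero _).2 fun x hx => hα ?_
    ext k
    rw [alphaMap_eq_smashRep hS' hσ, map_zero]
    simp [← hΘ1, ← hpa, hx, sw]
  have hqinj : Function.Injective q := by
    refine (injective_iff_map_eq_zero _).2 fun z hz => ?_
    obtain ⟨t, rfl⟩ := toTensorHit_surjective z
    suffices t = 0 by rw [this, map_zero]
    refine hα ?_
    ext k
    have h0 (c : A ⊗[R] H) : tensorRep U A (toTensorHit A U t) c = 0 :=
      hΘ (by rw [← hqa, hz, map_zero]; rfl)
    rw [alphaMap_eq_evalHit hS', map_zero]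
    simp [evalHit_apply, h0, sw]
  -- Both operators are right A-linear, and a ⊗ k = (1 ⊗ k)(a ⊗ 1), so agreement at γ'(k) = Θ(1 ⊗ k)
  -- suffices.
  have hpq (x t) (h : ∀ k, smashRep act σ U x (gammaInv S' σ' k) = Θ (evalHit A U t k)) :
      p x = q (toTensorHit A U t) := by
    refine TensorProduct.ext' fun a k => ?_
    have e : a ⊗ₜ[R] k = (1 ⊗ₜ k) * (a ⊗ₜ 1) := by
      rw [Algebra.TensorProduct.tmul_mul_tmul, mul_one, one_mul]
    rw [hpa, hqa, e, tensorRep_mul_tmul_one, theta_mul_tmul_one hσ, theta_mul_tmul_one hσ,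
      smashRep_crossedMul_tmul_one hσ, hΘ1, h]
    rfl
  have hrange : LinearMap.range p = LinearMap.range q := by
    apply le_antisymm
    · rintro _ ⟨x, rfl⟩
      obtain ⟨t, ht⟩ := exists_evalHit_eq_smashRep hS' hσ hVU x
      exact ⟨_, (hpq x t ht).symm⟩
    · rintro _ ⟨z, rfl⟩
      obtain ⟨t, rfl⟩ := toTensorHit_surjective z
      obtain ⟨x, hx⟩ := exists_smashRep_eq_evalHit hS' hσ hVU t
      exact ⟨x, hpq x t hx⟩
  let e := LinearEquiv.ofInjective p hpinj ≪≫ₗ LinearEquiv.ofEq _ _ hrange ≪≫ₗ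
    (LinearEquiv.ofInjective q hqinj).symm
  have he (x) : q (e x) = p x :=
    congrArg Subtype.val ((LinearEquiv.ofInjective q hqinj).apply_symm_apply _)
  refine ⟨e, fun x y => hqinj ?_, fun hε => ?_⟩
  · rw [he]
    refine LinearMap.ext fun c => ?_
    rw [hpa, smashRep_smashMul hσ, Module.End.mul_apply, ← hpa, ← he y, hqa, ← hpa, ← he x, hqa,
      hqa, tensorRep_mul, Module.End.mul_apply]
  · have hc (k : H) : leftHit (counit (R := R)) k = k := by
      rw [leftHit_apply]
      exact sw_counit_right R k fun k => k
    have h1 : (1 : Module.End R H) ∈ hitAlgebra U :=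
      ⟨1 ⊗ₜ ⟨counit, hε⟩, LinearMap.ext fun k => by simp [hc]⟩
    refine ⟨h1, hqinj ?_⟩
    rw [he]
    refine TensorProduct.ext' fun a k => ?_
    have hc' : leftHit (counit (R := R) (A := H)) = .id := LinearMap.ext hc
    rw [hpa, hqa, smashRep_tmul, hσ.one_mul, hit, hc', LinearMap.lTensor_id, tensorRep_tmul, one_mul]
    rfl

end Isomorphism

/-! ### Purity and injectivity of α -/

section Purity

variable {R : Type u} [CommRing R] {W : Type*} [AddCommMonoid W] [Module R W]
  {U : Submodule R (Module.Dual R W)}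

theorem alphaMap_tmul {M : Type*} [AddCommMonoid M] [Module R M] (m : M) (f : U) (x : W) :
    alphaMap U M (m ⊗ₜ f) x = (f : Module.Dual R W) x • m := by
  simp [alphaMap]

theorem alphaMap_rTensor {M N : Type*} [AddCommMonoid M] [Module R M] [AddCommMonoid N]
    [Module R N] (f : M →ₗ[R] N) (t : M ⊗[R] U) (x : W) :
    alphaMap U N (f.rTensor U t) x = f (alphaMap U M t x) := by
  induction t with
  | zero => simp
  | add s t hs ht => simp only [map_add, LinearMap.add_apply, hs, ht]
  | tmul m g => simp only [LinearMap.rTensor_tmul, alphaMap_tmul, map_smul]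

/-- Over a Noetherian ring, `M ⊗ R^W → M^W` is injective. -/
theorem sum_tmul_eq_zero_of_forall_sum_smul_eq_zero [IsNoetherianRing R] {X M ι : Type*}
    [AddCommGroup M] [Module R M] [Fintype ι] (m : ι → M) (f : ι → X → R)
    (h : ∀ x, ∑ i, f i x • m i = 0) : ∑ i, m i ⊗ₜ[R] f i = 0 := by
  classical
  -- The relations among the m_i have finitely many generators, and each tuple (f_i(x))_i is a
  -- relation. One list of generators serves all x, so the tensor vanishes trivially.
  obtain ⟨n, c, hc⟩ := Submodule.fg_iff_exists_fin_generating_family.1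
    (IsNoetherian.noetherian (LinearMap.ker (Fintype.linearCombination R m)))
  have hx (x : X) : (fun i => f i x) ∈ Submodule.span R (Set.range c) := by
    rw [hc, LinearMap.mem_ker, Fintype.linearCombination_apply, h]
  choose y hy using fun x => (Submodule.mem_span_range_iff_exists_fun R).1 (hx x)
  refine sum_tmul_eq_zero_of_vanishesTrivially R
    ⟨n, fun i j => c j i, fun j x => y x j, fun i => ?_, fun j => ?_⟩
  · ext x
    have := congrFun (hy x) i
    simp only [Finset.sum_apply, Pi.smul_apply, smul_eq_mul] at this ⊢
    rw [← this]
    exact Finset.sum_congr rfl fun j _ => mul_comm _ _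
  · have : c j ∈ LinearMap.ker (Fintype.linearCombination R m) :=
      hc ▸ Submodule.subset_span (Set.mem_range_self j)
    rwa [LinearMap.mem_ker, Fintype.linearCombination_apply] at this

theorem IsPureFor.alphaMap_injective [IsNoetherianRing R] {M : Type*} [AddCommGroup M] [Module R M]
    (h : IsPureFor (toFunctions U) M) : Function.Injective (alphaMap U M) := by
  refine (injective_iff_map_eq_zero _).2 fun t ht => ?_
  obtain ⟨n, m, f, rfl⟩ := exists_sum_tmul_eq t
  have h0 : ∑ j, m j ⊗ₜ[R] toFunctions U (f j) = 0 :=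
    sum_tmul_eq_zero_of_forall_sum_smul_eq_zero _ _ fun x => by
      simpa [alphaMap_tmul, toFunctions] using LinearMap.congr_fun ht x
  refine (TensorProduct.comm R M U).injective (h ?_)
  simpa using congrArg (TensorProduct.comm R M (W → R)) h0

/-- Tensoring the injection K ⊗ M → L ⊗ M with the flat module N keeps it injective. -/
theorem IsPureFor.tensor {K L M N : Type*} [AddCommMonoid K] [Module R K] [AddCommMonoid L]
    [Module R L] [AddCommMonoid M] [Module R M] [AddCommMonoid N] [Module R N] [Module.Flat R N]
    {ι : K →ₗ[R] L} (h : IsPureFor ι M) : IsPureFor ι (M ⊗[R] N) := by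
  have h1 := Module.Flat.rTensor_preserves_injective_linearMap (M := N) _ h
  have h2 : ι.rTensor (M ⊗[R] N) = (TensorProduct.assoc R L M N).toLinearMap ∘ₗ
      (ι.rTensor M).rTensor N ∘ₗ (TensorProduct.assoc R K M N).symm.toLinearMap := by
    ext; simp
  rw [IsPureFor, h2]
  exact (TensorProduct.assoc R L M N).injective.comp
    (h1.comp (TensorProduct.assoc R K M N).symm.injective)

/-- Purity is tested in the universe of R only. A tensor involves finitely many elements of M, so M
may be replaced by the submodule they span, realised as a quotient of some R^n. -/
theorem IsPure.alphaMap_injective [IsNoetherianRing R] (h : IsPure (toFunctions U)) (M : Type*)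
    [AddCommGroup M] [Module R M] : Function.Injective (alphaMap U M) := by
  refine (injective_iff_map_eq_zero _).2 fun t ht => ?_
  obtain ⟨n, m, f, rfl⟩ := exists_sum_tmul_eq t
  let p := Fintype.linearCombination R m
  let q := (LinearMap.ker p).liftQ p le_rfl
  have hq : Function.Injective q := LinearMap.ker_eq_bot.1 (Submodule.ker_liftQ_eq_bot _ _ _ le_rfl)
  have hs : ∑ j, m j ⊗ₜ[R] f j = q.rTensor U
      (∑ j, (LinearMap.ker p).mkQ (Pi.single j 1) ⊗ₜ[R] f j) := by
    simp [q, p]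
  rw [hs] at ht ⊢
  have h0 := (injective_iff_map_eq_zero _).1
    (IsPureFor.alphaMap_injective (h ((Fin n → R) ⧸ LinearMap.ker p)))
    (∑ j, (LinearMap.ker p).mkQ (Pi.single j 1) ⊗ₜ[R] f j) (LinearMap.ext fun x => hq ?_)
  · rw [h0, map_zero]
  · rw [← alphaMap_rTensor, ht]
    simp

theorem IsPure.comp {K L M : Type*} [AddCommMonoid K] [Module R K] [AddCommMonoid L] [Module R L]
    [AddCommMonoid M] [Module R M] {f : L →ₗ[R] M} {g : K →ₗ[R] L} (hf : IsPure f)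
    (hg : IsPure g) : IsPure (f ∘ₗ g) := fun N _ _ => by
  rw [IsPureFor, LinearMap.rTensor_comp]
  exact (hf N).comp (hg N)

theorem IsPure.toFunctions_of_le {V : Submodule R (Module.Dual R W)} {hUV : U ≤ V}
    (hV : IsPure (toFunctions V)) (hU : IsPure (Submodule.inclusion hUV)) :
    IsPure (toFunctions U) := by
  rw [show toFunctions U = toFunctions V ∘ₗ Submodule.inclusion hUV from rfl]
  exact IsPure.comp hV hU

end Purity

/-! ### Density over QF rings -/

section Density

variable {R : Type u} [CommRing R]

theorem IsDenseIn.trans {M N : Type*} [AddCommMonoid M] [Module R M] [AddCommMonoid N]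
    [Module R N] {S T V : Set (M →ₗ[R] N)} (hST : IsDenseIn S T) (hTV : IsDenseIn T V) :
    IsDenseIn S V := by
  rw [isDenseIn_iff] at *
  refine ⟨hST.1.trans hTV.1, fun f hf F => ?_⟩
  obtain ⟨g, hg, hgf⟩ := hTV.2 f hf F
  obtain ⟨k, hk, hkg⟩ := hST.2 g hg F
  exact ⟨k, hk, fun x hx => (hkg x hx).trans (hgf x hx)⟩

/-- Over a QF ring, a submodule of `W^*` that separates the points of `W` is dense. -/
theorem isDenseIn_univ_of_injective_flip [IsQFRing R] {W : Type*} [AddCommGroup W] [Module R W]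
    {X : Submodule R (Module.Dual R W)} (hX : Function.Injective (X.subtype.flip)) :
    IsDenseIn (X : Set (Module.Dual R W)) Set.univ := by
  classical
  rw [isDenseIn_iff]
  refine ⟨Set.subset_univ _, fun f _ F => ?_⟩
  let r : Module.Dual R W →ₗ[R] (F → R) :=
    { toFun := fun g x => g x
      map_add' := fun _ _ => rfl
      map_smul' := fun _ _ => rfl }
  -- Since R is Noetherian, finitely many g_i ∈ X generate all restrictions of X to `F`.
  obtain ⟨n, c, hc⟩ := Submodule.fg_iff_exists_fin_generating_family.1
    (IsNoetherian.noetherian (X.map r))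
  choose g hg hgc using fun i => show c i ∈ X.map r from
    hc ▸ Submodule.subset_span (Set.mem_range_self i)
  let N := Submodule.span R (F : Set W)
  let e : N →ₗ[R] (Fin n → R) := LinearMap.pi fun i => g i ∘ₗ N.subtype
  -- On the span of `F` every a ∈ X is a combination of the g_i. A point there killed by all g_i is
  -- killed by X, hence is zero.
  have he : Function.Injective e := by
    refine (injective_iff_map_eq_zero _).2 fun y hy => Subtype.ext (hX (LinearMap.ext fun a => ?_))
    have ha : r a ∈ Submodule.span R (Set.range c) := hc ▸ Submodule.mem_map_of_mem a.2
    obtain ⟨b, hb⟩ := (Submodule.mem_span_range_iff_exists_fun R).1 ha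
    have h1 : Set.EqOn (a : Module.Dual R W) (∑ i, b i • g i : Module.Dual R W) N := by
      refine LinearMap.eqOn_span fun x hx => ?_
      have := congrFun hb ⟨x, hx⟩
      simp only [← hgc] at this
      simpa [r] using this.symm
    have h2 (i) : g i y = 0 := congrFun hy i
    simpa [h2] using h1 y.2
  -- Self-injectivity extends f from the span of `F`, embedded in R^n by the g_i, to a functional k
  -- on R^n. Its values on the standard basis are the coefficients of the approximation.
  obtain ⟨k, hk⟩ := Module.Injective.extension_property R R _ _ (inj := IsQFRing.injective_self)
    e he (f ∘ₗ N.subtype)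
  refine ⟨∑ i, k (Pi.single i 1) • g i, sum_mem fun i _ => X.smul_mem _ (hg i), fun x hx => ?_⟩
  have h1 : k (e ⟨x, Submodule.subset_span hx⟩) = f x := LinearMap.congr_fun hk _
  rw [← h1, LinearMap.pi_apply_eq_sum_univ k]
  have h2 (i j : Fin n) : (if i = j then (1 : R) else 0) = Pi.single (M := fun _ => R) i 1 j := by
    rw [Pi.single_apply, if_congr eq_comm rfl rfl]
  simp [e, mul_comm, h2, N]

end Density

end HopfDuality

end

open HopfDuality
theorem mainTheorem6 {R : Type u} [CommRing R] {H : Type v} [Ring H] [HopfAlgebra R H]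
    [Module.Projective R H] {A : Type w} [Ring A] [Algebra R A]
    -- a twisted antipode of `H`
    (S' : H →ₗ[R] H) (hS' : IsTwistedAntipode S')
    -- a right `H`-crossed product `A #_σ H` with invertible cocycle, `σ' = σ⁻¹`
    (act : H →ₗ[R] A →ₗ[R] A) (σ σ' : H ⊗[R] H →ₗ[R] A) (hσ : IsCrossedProduct act σ σ')
    -- a right `H`-module subalgebra `U ⊆ H^*`, a right `H`-submodule `V ⊆ H^*`
    (U : RightModuleSubalgebra R H)
    (V : Submodule R (Module.Dual R H)) (hV : ∀ f ∈ V, ∀ h : H, rightAct f h ∈ V)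
    (hVU : IsCompatible S' act σ σ' V U.toSubmodule) :
    -- the general case
    (IsDenseIn (U.toSubmodule : Set (Module.Dual R H)) Set.univ →
      Function.Injective (alphaMap U.toSubmodule (A ⊗[R] H)) →
      HasDenseDuality act σ U) ∧
    -- a sufficient condition for the injectivity of `α`
    (IsNoetherianRing R → IsPureFor (toFunctions U.toSubmodule) A →
      Function.Injective (alphaMap U.toSubmodule (A ⊗[R] H))) ∧
    -- the case of QF rings
    (∀ [IsQFRing R], IsResiduallyFinite R H → IsAlphaAlgebra R H →
      IsSubbialgebra U.toSubmodule →
      IsDenseIn (U.toSubmodule : Set (Module.Dual R H)) (finiteDual R H) →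
      IsDenseIn (U.toSubmodule : Set (Module.Dual R H)) Set.univ ∧
      Function.Injective (alphaMap U.toSubmodule (A ⊗[R] H)) ∧
      HasDenseDuality act σ U) := by
  refine ⟨fun hd hα => hasDenseDuality hS' hσ hVU hd hα, fun _ hA => ?_,
    fun hres hpure hU hdense => ?_⟩
  -- H is projective, hence flat, so A-purity upgrades to purity for A ⊗ H.
  · have h := IsPureFor.tensor (N := H) hA
    exact h.alphaMap_injective
  -- Residual finiteness says that H° separates the points of H, so H° is dense in H^*, and density
  -- is transitive.
  have hd := hdense.trans (isDenseIn_univ_of_injective_flip hres)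
  have hα := (hpure.toFunctions_of_le hU.pure).alphaMap_injective (A ⊗[R] H)
  exact ⟨hd, hα, hasDenseDuality hS' hσ hVU hd hα⟩
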